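/- Let $K$ be a field, $n\ge 0$ an integer, $S=K[x_1,\dots,x_n]$ and $\mathfrak m=(x_1,\dots,x_n)$. For $k\ge 1$ let $X_n^k$ be the labelled cell complex obtained from the Newton polytope of $\mathfrak m^k$ (the convex hull of the exponent vectors $a\in\mathbb N^n$ with $a_1+\dots+a_n=k$) by subdividing it with all hyperplanes $H_{i,j}=\{y\in\mathbb R^n : y_i=j\}$, $1\le i\le n$, $j\ge 0$. The vertex $a$ has label $x^a$, and a face $F$ has as its label $x^{a_F}$ the least common multiple of the labels of its vertices; the empty face has label $1$. The cells are given a fixed orientation that is invariant under integral translations: a cell whose non-constant coordinates are $i_0<\dots<i_d$ ($d\ge1$) is oriented by the basis $e_{i_1}-e_{i_0},\dots,e_{i_d}-e_{i_0}$ of its direction space, and vertices are oriented positively. Let $F^{(k)}$ be the cellular complex of $X_n^k$: its module $F^{(k)}_p$ is the free $S$-module on the faces of dimension $p-1$ (so $F^{(k)}_0=S$, on the empty face), and $$\partial(F)=\sum_{G}\operatorname{sign}(G,F)\,x^{a_F-a_G}\,G ,$$ the sum being over the facets $G$ of $F$ and the signs being the incidence numbers of the oriented complex. Let $\mathcal F$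 be the category with one object for each $k\ge1$, standing for $F^{(k)}$. Its morphisms are the chain maps that are compositions of zero or more multiplications by variables. Here a multiplication by $x_i$ is a chain map $f:F^{(k)}\to F^{(k+1)}$ such that $f_0$ is multiplication by $x_i$ and such that $f$ sends the generator of each face $F$ of $X_n^k$ to a nonzero multiple of the generator of the face $F+e_i$ of $X_n^{k+1}$. For $p\ge0$ let $$\sigma_p:\mathcal F\to\operatorname{Mod}_S,\qquad \sigma_p(F^{(k)})=\operatorname{im}\bigl(\partial:F^{(k)}_{p+1}\to F^{(k)}_p\bigr)\subseteq F^{(k)}_p ,$$ be the $p$-th syzygy representation, on which morphisms act by restricting the chain maps. **Theorem.** (1) For every $k\ge 1$ the complex $F^{(k)}$ is a cellular resolution of $S/\mathfrak m^k$: the sequence $\cdots\to F^{(k)}_2\to F^{(k)}_1\to F^{(k)}_0=S\to S/\mathfrak m^k\to 0$ is exact. (In particular $\sigma_p(F^{(k)})=\ker(F^{(k)}_p\to F^{(k)}_{p-1})$ for $p\ge1$, and $\sigma_0(F^{(k)})=\mathfrak m^k$.) (2) For every $p\ge0$ the representation $\sigma_p$ is finitely generated: there are finitely many elements $e_r\in\sigma_p(F^{(k_r)})$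 such that the only subrepresentation (subfunctor) of $\sigma_p$ containing all of them is $\sigma_p$ itself. -/

import Mathlib

open CategoryTheory

universe u v w

/-! ## Representations of categories -/

namespace CategoryRep

variable {C : Type v} [Category.{w} C] {R : Type u} [CommRing R]

/-- A subrepresentation (subfunctor) of a representation `M : C ⥤ Mod_R`. -/
structure Subrepresentation (M : C ⥤ ModuleCat.{u} R) where
  /-- the submodule at each object -/
  obj : ∀ x : C, Submodule R (M.obj x)
  map_mem : ∀ {x y : C} (f : x ⟶ y) {a : M.obj x}, a ∈ obj x → (M.map f).hom a ∈ obj y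

/-- A subrepresentation, regarded as a representation by restricting the maps of `M`. -/
noncomputable def Subrepresentation.toFunctor {M : C ⥤ ModuleCat.{u} R}
    (N : Subrepresentation M) : C ⥤ ModuleCat.{u} R where
  obj x := ModuleCat.of R (N.obj x)
  map f := ModuleCat.ofHom ((M.map f).hom.restrict fun _ ha => N.map_mem f ha)
  map_id x := by
    ext a
    simp [LinearMap.restrict_apply]
  map_comp f g := by
    ext a
    simp [LinearMap.restrict_apply]

/-- A representation is finitely generated if there is a finite set of elements (an element being
an element of some `M.obj x`) such that the only, and hence the smallest, subrepresentation
containing it is the whole representation. -/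
def IsFinitelyGenerated (M : C ⥤ ModuleCat.{u} R) : Prop :=
  ∃ s : Set (Σ x : C, M.obj x), s.Finite ∧
    ∀ N : Subrepresentation M, (∀ e ∈ s, e.2 ∈ N.obj e.1) → ∀ x : C, N.obj x = ⊤

end CategoryRep

/-! ## The subdivided simplices -/

namespace SubdividedSimplex

/-- The point of `ℝⁿ` given by the exponent vector of a monomial. -/
def point {n : ℕ} (a : Fin n →₀ ℕ) : Fin n → ℝ := fun i => (a i : ℝ)

/-- The exponent vectors of the monomials of degree `k` in `n` variables. -/
def exponents (n k : ℕ) : Finset (Fin n →₀ ℕ) := Finset.finsuppAntidiag Finset.univ k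

/-- The Newton polytope of `𝔪ᵏ`: the convex hull of the exponent vectors of the monomials of
degree `k`, which are the minimal generators of `𝔪ᵏ`. -/
def newtonPolytope (n k : ℕ) : Set (Fin n → ℝ) :=
  convexHull ℝ (point '' (exponents n k : Set (Fin n →₀ ℕ)))

/-- The relatively open cell through `y` of the subdivision of the Newton polytope by all the
hyperplanes `{z | z i = j}`, `j ≥ 0`: the points of the polytope that lie on the same side as `y`
of each of these hyperplanes (or on the hyperplane, if `y` does). -/
def openCell (n k : ℕ) (y : Fin n → ℝ) : Set (Fin n → ℝ) :=
  {z | z ∈ newtonPolytope n k ∧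
    ∀ (i : Fin n) (j : ℕ), SignType.sign (z i - (j : ℝ)) = SignType.sign (y i - (j : ℝ))}

/-- The faces of the complex, represented by their relative interiors: the empty face, and the
cells of the subdivision. -/
def IsFace (n k : ℕ) (F : Set (Fin n → ℝ)) : Prop :=
  F = ∅ ∨ ∃ y ∈ newtonPolytope n k, F = openCell n k y

open Classical in
/-- `1 + dim F`, where the empty face has dimension `-1`. -/
noncomputable def rank {n : ℕ} (F : Set (Fin n → ℝ)) : ℕ :=
  if F = ∅ then 0 else Module.finrank ℝ (vectorSpan ℝ F) + 1

/-- The faces of dimension `p - 1`. -/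
def Face (n k p : ℕ) : Type := {F : Set (Fin n → ℝ) // IsFace n k F ∧ rank F = p}

theorem apply_le_of_mem {n k : ℕ} {y : Fin n → ℝ} (hy : y ∈ newtonPolytope n k) (i : Fin n) :
    y i ≤ (k : ℝ) := by
  have hconv : Convex ℝ {z : Fin n → ℝ | z i ≤ (k : ℝ)} :=
    convex_halfSpace_le (f := fun z : Fin n → ℝ => z i) ⟨fun _ _ => rfl, fun _ _ => rfl⟩ _
  refine convexHull_min ?_ hconv hy
  rintro _ ⟨a, ha, rfl⟩
  have hsum : ∑ j, a j = k := by
    have := (Finset.mem_finsuppAntidiag.1 (Finset.mem_coe.1 ha)).1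
    simpa using this
  have : a i ≤ k := hsum ▸ Finset.single_le_sum (fun _ _ => Nat.zero_le _) (Finset.mem_univ i)
  simpa [point] using this

instance (n k p : ℕ) : Finite (Face n k p) := by
  have hfin : {F : Set (Fin n → ℝ) | IsFace n k F}.Finite := by
    let Φ : (Fin n → Fin (k + 1) → SignType) → Set (Fin n → ℝ) := fun s =>
      {z | z ∈ newtonPolytope n k ∧
        ∀ (i : Fin n) (j : Fin (k + 1)), SignType.sign (z i - ((j : ℕ) : ℝ)) = s i j}
    refine ((Set.finite_range Φ).insert ∅).subset ?_
    rintro F (rfl | ⟨y, hy, rfl⟩)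
    · exact Set.mem_insert _ _
    · refine Set.mem_insert_of_mem _ ⟨fun i j => SignType.sign (y i - ((j : ℕ) : ℝ)), ?_⟩
      ext z
      refine ⟨fun hz => ⟨hz.1, fun i j => ?_⟩, fun hz => ⟨hz.1, fun i j => hz.2 i j⟩⟩
      by_cases hj : j < k + 1
      · exact hz.2 i ⟨j, hj⟩
      · have hkj : (k : ℝ) < (j : ℝ) := by exact_mod_cast (by omega : k < j)
        have h1 : z i - (j : ℝ) < 0 := by linarith [apply_le_of_mem hz.1 i]
        have h2 : y i - (j : ℝ) < 0 := by linarith [apply_le_of_mem hy i]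
        rw [sign_neg h1, sign_neg h2]
  have : Finite {F : Set (Fin n → ℝ) // IsFace n k F} := hfin.to_subtype
  exact Finite.of_injective
    (fun F : Face n k p => (⟨F.1, F.2.1⟩ : {F : Set (Fin n → ℝ) // IsFace n k F}))
    fun F G h => Subtype.ext (congrArg (fun H => H.1) h)

noncomputable instance (n k p : ℕ) : Fintype (Face n k p) := Fintype.ofFinite _

/-- The empty face. -/
def emptyFace (n k : ℕ) : Face n k 0 := ⟨∅, Or.inl rfl, by simp [rank]⟩

open Classical in
/-- The exponent vector of the label of a face: the least common multiple of the labels of its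
vertices. The vertices are the exponent vectors of the monomials of degree `k`, each labelled by
its monomial. The empty face gets the label `1`. -/
noncomputable def label {n k p : ℕ} (F : Face n k p) : Fin n →₀ ℕ :=
  ((exponents n k).filter fun a => point a ∈ closure F.1).sup id

open Classical in
/-- The coordinates that are not constant on a face. -/
noncomputable def moving {n k p : ℕ} (F : Face n k p) : Finset (Fin n) :=
  Finset.univ.filter fun i => ∃ y ∈ F.1, ∃ z ∈ F.1, y i ≠ z i

open Classical in
/-- The incidence number of a face `F` and a facet `G` of it, that is, of a face
`G ⊆ closure F` of one dimension less.

A face of dimension `d ≥ 1` whose moving coordinates are `i₀ < i₁ < ⋯ < i_d` is oriented by the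
basis `e_{i₁} - e_{i₀}, …, e_{i_d} - e_{i₀}` of its direction space, vertices are positively
oriented, and the incidence number compares the orientation of `G` with the one that `F` induces on
its boundary by the rule "outward normal first". It is `(-1)ʲ` if `G` is cut out of the closure of
`F` by the lower bound of the coordinate `i_j`, and `-(-1)ʲ` if it is cut out by the upper bound.
(If `F` is an edge, this is the case for two coordinates, which give the same sign; the smaller
one is used.) The incidence number of a vertex and the empty face is `1`. -/
noncomputable def incidence {n k p q : ℕ} (G : Face n k q) (F : Face n k p) : ℤ :=
  if h : (moving F \ moving G).Nonempty then
    (-1) ^ ((moving F).filter fun j => j < (moving F \ moving G).min' h).card *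
      (if ∀ y ∈ G.1, ∀ z ∈ F.1,
          y ((moving F \ moving G).min' h) ≤ z ((moving F \ moving G).min' h) then 1 else -1)
  else 1

/-! ## The cellular complex -/

/-- The `p`-th free module of the cellular complex: the free module over `S = K[x₁,…,xₙ]` on the
faces of dimension `p - 1`. -/
abbrev FreeMod (K : Type u) [Field K] (n k p : ℕ) : Type u := Face n k p →₀ MvPolynomial (Fin n) K

open Classical in
/-- The differential `∂ F = ∑_G sign(G, F) x^{a_F - a_G} G` of the cellular complex, from the free
module in homological degree `p + 1` to the one in degree `p`. -/
noncomputable def boundary (K : Type u) [Field K] (n k p : ℕ) :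
    FreeMod K n k (p + 1) →ₗ[MvPolynomial (Fin n) K] FreeMod K n k p :=
  Finsupp.linearCombination (MvPolynomial (Fin n) K) fun F : Face n k (p + 1) =>
    ∑ G : Face n k p, if G.1 ⊆ closure F.1 then
      Finsupp.single G (MvPolynomial.monomial (label F - label G) (incidence G F : K)) else 0

/-- The maximal monomial ideal `(x₁, …, xₙ)`. -/
noncomputable def maxIdeal (K : Type u) [Field K] (n : ℕ) : Ideal (MvPolynomial (Fin n) K) :=
  Ideal.span (Set.range MvPolynomial.X)

/-- The augmentation onto `S/𝔪ᵏ`, sending the generator of the free module in degree `0` (the empty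
face) to `1`. -/
noncomputable def augmentation (K : Type u) [Field K] (n k : ℕ) :
    FreeMod K n k 0 →ₗ[MvPolynomial (Fin n) K] (MvPolynomial (Fin n) K ⧸ maxIdeal K n ^ k) :=
  Finsupp.linearCombination (MvPolynomial (Fin n) K) fun _ => 1

/-- The cellular complex supported on the subdivided simplex is a resolution of `S/𝔪ᵏ`:
`⋯ ⟶ F₂ ⟶ F₁ ⟶ F₀ ⟶ S/𝔪ᵏ ⟶ 0` is an exact complex. -/
structure IsCellularResolution (K : Type u) [Field K] (n k : ℕ) : Prop where
  exact : ∀ p : ℕ, Function.Exact (boundary K n k (p + 1)) (boundary K n k p)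
  exact_zero : Function.Exact (boundary K n k 0) (augmentation K n k)
  surjective : Function.Surjective (augmentation K n k)

/-- Chain maps between the cellular complexes for `𝔪ᵏ` and `𝔪ˡ`. -/
@[ext]
structure ChainMap (K : Type u) [Field K] (n k l : ℕ) where
  /-- the components of the chain map -/
  app : ∀ p : ℕ, FreeMod K n k p →ₗ[MvPolynomial (Fin n) K] FreeMod K n l p
  comm : ∀ p : ℕ, boundary K n l p ∘ₗ app (p + 1) = app p ∘ₗ boundary K n k p

/-- The identity chain map. -/
noncomputable def ChainMap.id (K : Type u) [Field K] (n k : ℕ) : ChainMap K n k k where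
  app _ := LinearMap.id
  comm _ := rfl

/-- The composition of chain maps, `f` first. -/
noncomputable def ChainMap.comp {K : Type u} [Field K] {n j k l : ℕ} (f : ChainMap K n j k)
    (g : ChainMap K n k l) : ChainMap K n j l where
  app p := g.app p ∘ₗ f.app p
  comm p := by
    rw [← LinearMap.comp_assoc, g.comm, LinearMap.comp_assoc, f.comm, LinearMap.comp_assoc]

/-- The chain map `f` is multiplication by the variable `xᵢ`, from one power of `𝔪` to the next: it
is multiplication by `xᵢ` in degree `0`, and it is compatible with the cellular map that embeds one
subdivided simplex into the next one by the translation `y ↦ y + eᵢ` (which takes a vertex with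
label `m` to the vertex with label `xᵢ m`), in that the generator of a face is sent to a nonzero
multiple of the generator of its translate. -/
structure IsVariableMul {K : Type u} [Field K] {n k l : ℕ} (i : Fin n) (f : ChainMap K n k l) :
    Prop where
  succ : l = k + 1
  app_zero : f.app 0 (Finsupp.single (emptyFace n k) 1) =
    Finsupp.single (emptyFace n l) (MvPolynomial.X i)
  compatible : ∀ (p : ℕ) (F : Face n k p), ∃ G : Face n l p,
    G.1 = (fun y => y + Pi.single i (1 : ℝ)) '' F.1 ∧
      ∃ c : MvPolynomial (Fin n) K, c ≠ 0 ∧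
        f.app p (Finsupp.single F 1) = Finsupp.single G c

/-- The chain maps that are compositions of (zero or more) multiplications by variables. -/
inductive IsComposite {K : Type u} [Field K] {n : ℕ} :
    ∀ {k l : ℕ}, ChainMap K n k l → Prop
  | id (k : ℕ) : IsComposite (ChainMap.id K n k)
  | comp {j k l : ℕ} {f : ChainMap K n j k} {g : ChainMap K n k l} (i : Fin n) :
      IsComposite f → IsVariableMul i g → IsComposite (f.comp g)

theorem IsComposite.trans {K : Type u} [Field K] {n j k l : ℕ} {f : ChainMap K n j k}
    {g : ChainMap K n k l} (hf : IsComposite f) (hg : IsComposite g) :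
    IsComposite (f.comp g) := by
  induction hg with
  | id => exact hf
  | @comp _ _ f' g' i _ h ih => exact IsComposite.comp (f := f.comp f') (g := g') i ih h

/-! ## The family and its syzygy representations -/

/-- The objects of the family of cellular resolutions of `S/𝔪ᵏ`, `k ≥ 1`, supported on the
subdivided simplices. The object with `power = k` stands for the resolution of `S/𝔪ᵏ`. -/
structure Family (K : Type u) [Field K] (n : ℕ) where
  /-- the exponent `k` of `𝔪ᵏ` -/
  power : ℕ
  pos : 0 < power

/-- The morphisms of the family: between consecutive powers the multiplications by variables, and
otherwise the compositions of those (and identities), one morphism for each chain map. -/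
noncomputable instance (K : Type u) [Field K] (n : ℕ) : Category.{u} (Family K n) where
  Hom F G := {f : ChainMap K n F.power G.power // IsComposite f}
  id F := ⟨ChainMap.id K n F.power, IsComposite.id _⟩
  comp f g := ⟨f.1.comp g.1, f.2.trans g.2⟩
  id_comp _ := rfl
  comp_id _ := rfl
  assoc _ _ _ := rfl

/-- The `p`-th module representation `s_p`: it takes a resolution to its `p`-th free module, and a
morphism to the `p`-th component of the chain map. -/
noncomputable def moduleRep (K : Type u) [Field K] (n p : ℕ) :
    Family K n ⥤ ModuleCat.{u} (MvPolynomial (Fin n) K) where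
  obj F := ModuleCat.of (MvPolynomial (Fin n) K) (FreeMod K n F.power p)
  map f := ModuleCat.ofHom (f.1.app p)
  map_id _ := rfl
  map_comp _ _ := rfl

/-- The subrepresentation of `s_p` formed by the `p`-th syzygy modules
`im (∂ : F_{p+1} ⟶ F_p) ⊆ F_p`. -/
noncomputable def syzygySub (K : Type u) [Field K] (n p : ℕ) :
    CategoryRep.Subrepresentation (moduleRep K n p) where
  obj F := LinearMap.range (boundary K n F.power p)
  map_mem f _ h := by
    obtain ⟨b, rfl⟩ := h
    exact ⟨f.1.app (p + 1) b, LinearMap.congr_fun (f.1.comm p) b⟩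

/-- The `p`-th syzygy representation `σ_p`. -/
noncomputable def syzygyRep (K : Type u) [Field K] (n p : ℕ) :
    Family K n ⥤ ModuleCat.{u} (MvPolynomial (Fin n) K) :=
  (syzygySub K n p).toFunctor

end SubdividedSimplex

namespace SubdividedSimplex
variable {n k p : ℕ}

/-! ## The cells in coordinates -/

/-! Which side of every hyperplane a point lies on is decided by the integer parts of its
coordinates and by which coordinates are integral. So the nonempty open cells are the sets `cell k a
I`, translates by a lower corner `a` of open hypersimplices in the coordinates `I`: the offsets from
`a` lie in (0,1) on `I` and add up to k - |a|. Such a cell exists iff `I` is empty and |a| = k, or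
|a| < k < |a| + |I|. Its dimension is |I| - 1 (0 if `I` is empty) and its label is `a` plus the
indicator of `I`. All geometry thereby becomes arithmetic of pairs (a, I).

Part (1). The incidence matrices compose to zero because between two cells of codimension two there
are exactly two cells, with opposite contributions (`sum_inc_mul_inc`). The differential is
multigraded, and in multidegree c it is the augmented cellular complex over `K` of the cells whose
label is at most c. If |c| < k there are none but the empty face; if |c| ≥ k this subcomplex must be
acyclic (`exists_mulVec_eq`), which is proved by induction on |c|. For |c| = k its only nonempty
cell is the vertex c. For |c| > k fix m with c m > 0. The cells to be removed in order to pass from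
c to c - e_m are those whose label has exponent exactly c m at m. A discrete Morse matching cancels
them: normally a cell moving in direction m is paired with its upper m-facet. If |a| = k - 1 and the
cell is not an edge, this facet is degenerate, and an auxiliary coordinate `ι a` is added to or
removed from `I` instead. `exists_up` and `exists_down` show that the matching is triangular, and
`exists_sub_mulVec_support` is the linear algebra which then moves a cycle into the smaller
subcomplex.

Part (2). Translation by e_i preserves incidence and multiplies the label of a nonempty cell by x_i,
so it gives a multiplication by x_i that sends ∂F to ∂(F + e_i) (`mulVar_boundary`). A
positive-dimensional cell with lower corner 0 has k < |I| ≤ n, so for k > n every cell has a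
positive corner coordinate and, if k > 1, is a translate from the preceding power. Hence the
syzygies ∂F for the powers up to n + 1 generate. -/

theorem sum_eq_of_mem_exponents {a : Fin n →₀ ℕ} : a ∈ exponents n k ↔ ∑ i, a i = k := by
  simp [exponents, Finset.mem_finsuppAntidiag]

theorem mem_newtonPolytope (hk : 0 < k) {y : Fin n → ℝ} :
    y ∈ newtonPolytope n k ↔ (∀ i, 0 ≤ y i) ∧ ∑ i, y i = k := by
  constructor
  · intro hy
    have hconv : Convex ℝ {z : Fin n → ℝ | (∀ i, 0 ≤ z i) ∧ ∑ i, z i = k} := by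
      intro z hz w hw s t hs ht hst
      refine ⟨fun i => ?_, ?_⟩
      · simp only [Pi.add_apply, Pi.smul_apply, smul_eq_mul]
        have := hz.1 i
        have := hw.1 i
        positivity
      · simp only [Pi.add_apply, Pi.smul_apply, smul_eq_mul, Finset.sum_add_distrib,
          ← Finset.mul_sum, hz.2, hw.2, ← add_mul, hst, one_mul]
    refine convexHull_min ?_ hconv hy
    rintro _ ⟨a, ha, rfl⟩
    refine ⟨fun i => by simp [point], ?_⟩
    have := sum_eq_of_mem_exponents.1 (Finset.mem_coe.1 ha)
    simp only [point]
    exact_mod_cast this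
  · rintro ⟨h0, hs⟩
    have hk' : (k : ℝ) ≠ 0 := by positivity
    -- The corners k·e_i suffice, and y i / k are the barycentric coordinates; this needs k ≠ 0.
    have hy : y = ∑ i, (y i / k) • point (Finsupp.single i k) := by
      ext j
      simp only [Finset.sum_apply, Pi.smul_apply, smul_eq_mul, point, Finsupp.single_apply]
      rw [Finset.sum_eq_single j]
      · simp [hk']
      · intro b _ hb
        simp [hb]
      · simp
    rw [hy]
    refine (convex_convexHull ℝ _).sum_mem (fun i _ => div_nonneg (h0 i) (by positivity)) ?_ ?_
    · rw [← Finset.sum_div, hs, div_self hk']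
    · intro i _
      refine subset_convexHull ℝ _ ⟨_, ?_, rfl⟩
      rw [Finset.mem_coe, sum_eq_of_mem_exponents]
      simp [Finsupp.single_apply]

/-- The relatively open cell with lower corner `a` whose non-constant coordinates are those
in `I`. -/
def cell (k : ℕ) (a : Fin n → ℕ) (I : Finset (Fin n)) : Set (Fin n → ℝ) :=
  {y | (∀ i ∈ I, (a i : ℝ) < y i ∧ y i < a i + 1) ∧ (∀ i ∉ I, y i = a i) ∧ ∑ i, y i = k}

/-- The pairs of a lower corner and a set of moving coordinates that give a nonempty cell. -/
def IsCell (k : ℕ) (a : Fin n → ℕ) (I : Finset (Fin n)) : Prop :=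
  (I = ∅ ∧ ∑ i, a i = k) ∨ (∑ i, a i < k ∧ k < ∑ i, a i + I.card)

theorem IsCell.two_le_card {a : Fin n → ℕ} {I : Finset (Fin n)} (h : IsCell k a I)
    (hI : I.Nonempty) : 2 ≤ I.card := by
  rcases h with ⟨rfl, _⟩ | h
  · simp at hI
  · omega

theorem sum_indicator_add (a : Fin n → ℕ) (I : Finset (Fin n)) (t : ℝ) :
    ∑ i, ((a i : ℝ) + if i ∈ I then t else 0) = (∑ i, a i : ℕ) + I.card * t := by
  rw [Finset.sum_add_distrib]
  simp

theorem IsCell.nonempty {a : Fin n → ℕ} {I : Finset (Fin n)} (h : IsCell k a I) :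
    (cell k a I).Nonempty := by
  rcases h with ⟨rfl, h⟩ | ⟨h1, h2⟩
  · exact ⟨fun i => a i, by simp, by simp, by beta_reduce; exact_mod_cast h⟩
  · have hI : (0 : ℝ) < I.card := by exact_mod_cast (by omega : 0 < I.card)
    have h1' : ((∑ i, a i : ℕ) : ℝ) < k := by exact_mod_cast h1
    have h2' : (k : ℝ) < (∑ i, a i : ℕ) + I.card := by exact_mod_cast h2
    -- The missing degree k - |a| is shared equally among `I`; the two inequalities say that each
    -- share is strictly between 0 and 1.
    refine ⟨fun i => a i + if i ∈ I then ((k : ℝ) - (∑ i, a i : ℕ)) / I.card else 0, ?_, ?_, ?_⟩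
    · intro i hi
      simp only [hi, if_true]
      constructor
      · have : 0 < ((k : ℝ) - (∑ i, a i : ℕ)) / I.card := div_pos (by linarith) hI
        linarith
      · have : ((k : ℝ) - (∑ i, a i : ℕ)) / I.card < 1 := by
          rw [div_lt_one hI]; linarith
        linarith
    · intro i hi
      simp [hi]
    · rw [sum_indicator_add]
      field_simp
      ring

theorem isCell_of_mem {a : Fin n → ℕ} {I : Finset (Fin n)} {y : Fin n → ℝ}
    (h : y ∈ cell k a I) : IsCell k a I := by
  obtain ⟨h1, h2, h3⟩ := h
  rcases I.eq_empty_or_nonempty with rfl | hI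
  · left
    refine ⟨rfl, ?_⟩
    have : ∑ i, y i = ∑ i, (a i : ℝ) := Finset.sum_congr rfl fun i _ => h2 i (by simp)
    rw [this] at h3
    exact_mod_cast h3
  · right
    obtain ⟨i, hi⟩ := hI
    constructor
    · have : ∑ i, (a i : ℝ) < ∑ i, y i := by
        refine Finset.sum_lt_sum (fun j _ => ?_) ⟨i, Finset.mem_univ i, (h1 i hi).1⟩
        by_cases hj : j ∈ I
        · exact (h1 j hj).1.le
        · exact (h2 j hj).ge
      rw [h3] at this
      exact_mod_cast this
    · have : ∑ i, y i < ∑ i, ((a i : ℝ) + if i ∈ I then 1 else 0) := by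
        refine Finset.sum_lt_sum (fun j _ => ?_)
          ⟨i, Finset.mem_univ i, by simpa [hi] using (h1 i hi).2⟩
        by_cases hj : j ∈ I
        · simpa [hj] using (h1 j hj).2.le
        · simpa [hj] using (h2 j hj).le
      rw [h3, sum_indicator_add, mul_one] at this
      exact_mod_cast this

theorem floor_of_mem_cell {a : Fin n → ℕ} {I : Finset (Fin n)} {y : Fin n → ℝ}
    (h : y ∈ cell k a I) (i : Fin n) : ⌊y i⌋₊ = a i := by
  by_cases hi : i ∈ I
  · have := h.1 i hi
    rw [Nat.floor_eq_iff (by have : (0 : ℝ) ≤ a i := by positivity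
                             linarith)]
    exact ⟨this.1.le, this.2⟩
  · rw [h.2.1 i hi, Nat.floor_natCast]

theorem mem_iff_of_mem_cell {a : Fin n → ℕ} {I : Finset (Fin n)} {y : Fin n → ℝ}
    (h : y ∈ cell k a I) (i : Fin n) : i ∈ I ↔ y i ≠ a i :=
  ⟨fun hi => (h.1 i hi).1.ne', fun hne => by_contra fun hi => hne (h.2.1 i hi)⟩

theorem apply_nonneg_of_mem_cell {a : Fin n → ℕ} {I : Finset (Fin n)} {y : Fin n → ℝ}
    (h : y ∈ cell k a I) (i : Fin n) : 0 ≤ y i := by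
  have : (0 : ℝ) ≤ a i := by positivity
  by_cases hi : i ∈ I
  · exact this.trans (h.1 i hi).1.le
  · rw [h.2.1 i hi]; exact this

theorem mem_cell_floor (hk : 0 < k) {y : Fin n → ℝ} (hy : y ∈ newtonPolytope n k) :
    y ∈ cell k (fun i => ⌊y i⌋₊) (Finset.univ.filter fun i => y i ≠ ⌊y i⌋₊) := by
  obtain ⟨h0, hs⟩ := (mem_newtonPolytope hk).1 hy
  refine ⟨fun i hi => ⟨?_, Nat.lt_floor_add_one _⟩, fun i hi => ?_, hs⟩
  · exact lt_of_le_of_ne (Nat.floor_le (h0 i)) (by simpa using Ne.symm (Finset.mem_filter.1 hi).2)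
  · simpa using hi

/-- The signs tell which integers are at most x, hence the floor, and whether x equals its floor. No
other information is in them. -/
theorem sign_sub_eq_iff {x y : ℝ} (hx : 0 ≤ x) (hy : 0 ≤ y) :
    (∀ j : ℕ, SignType.sign (x - (j : ℝ)) = SignType.sign (y - (j : ℝ))) ↔
      ⌊x⌋₊ = ⌊y⌋₊ ∧ (x = ⌊x⌋₊ ↔ y = ⌊y⌋₊) := by
  constructor
  · intro h
    have hle : ∀ j : ℕ, (j : ℝ) ≤ x ↔ (j : ℝ) ≤ y := fun j => by
      rw [← sub_nonneg, ← sub_nonneg (a := y), ← sign_nonneg_iff, h, sign_nonneg_iff]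
    have hf : ⌊x⌋₊ = ⌊y⌋₊ :=
      le_antisymm (Nat.le_floor ((hle _).1 (Nat.floor_le hx)))
        (Nat.le_floor ((hle _).2 (Nat.floor_le hy)))
    refine ⟨hf, ?_⟩
    rw [← sub_eq_zero, ← sign_eq_zero_iff, h, sign_eq_zero_iff, sub_eq_zero, hf]
  · rintro ⟨hf, he⟩ j
    rcases lt_trichotomy j ⌊x⌋₊ with hj | hj | hj
    · have h1 : (j : ℝ) < x := lt_of_lt_of_le (by exact_mod_cast hj) (Nat.floor_le hx)
      have h2 : (j : ℝ) < y := lt_of_lt_of_le (by rw [hf] at hj; exact_mod_cast hj)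
        (Nat.floor_le hy)
      rw [sign_pos (sub_pos.2 h1), sign_pos (sub_pos.2 h2)]
    · by_cases hx' : x = ⌊x⌋₊
      · have hy' := he.1 hx'
        rw [sub_eq_zero.2 (by rw [hj]; exact hx'), sub_eq_zero.2 (by rw [hj, hf]; exact hy')]
      · have hy' := fun h => hx' (he.2 h)
        have h1 : (j : ℝ) < x := lt_of_le_of_ne (hj ▸ Nat.floor_le hx) (hj ▸ Ne.symm hx')
        have h2 : (j : ℝ) < y := by
          rw [hj, hf]
          exact lt_of_le_of_ne (Nat.floor_le hy) (Ne.symm hy')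
        rw [sign_pos (sub_pos.2 h1), sign_pos (sub_pos.2 h2)]
    · have h1 : x < j := (Nat.floor_lt hx).1 hj
      have h2 : y < j := (Nat.floor_lt hy).1 (hf ▸ hj)
      rw [sign_neg (sub_neg.2 h1), sign_neg (sub_neg.2 h2)]

theorem openCell_eq_cell (hk : 0 < k) {a : Fin n → ℕ} {I : Finset (Fin n)} {y : Fin n → ℝ}
    (h : y ∈ cell k a I) : openCell n k y = cell k a I := by
  have hy0 := apply_nonneg_of_mem_cell h
  ext z
  constructor
  · rintro ⟨hz, hs⟩
    obtain ⟨hz0, hzs⟩ := (mem_newtonPolytope hk).1 hz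
    have key := fun i => (sign_sub_eq_iff (hz0 i) (hy0 i)).1 (hs i)
    have hmem := mem_cell_floor hk hz
    have hfl : (fun i => ⌊z i⌋₊) = a := funext fun i => by
      rw [(key i).1, floor_of_mem_cell h]
    have hI : (Finset.univ.filter fun i => z i ≠ ⌊z i⌋₊) = I := by
      ext i
      rw [Finset.mem_filter, mem_iff_of_mem_cell h, ← floor_of_mem_cell h, ne_eq, (key i).2]
      simp
    rwa [hfl, hI] at hmem
  · intro hz
    have hz0 := apply_nonneg_of_mem_cell hz
    refine ⟨(mem_newtonPolytope hk).2 ⟨hz0, hz.2.2⟩, fun i => ?_⟩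
    rw [sign_sub_eq_iff (hz0 i) (hy0 i), floor_of_mem_cell h, floor_of_mem_cell hz]
    refine ⟨rfl, ?_⟩
    rw [← not_iff_not]
    exact (mem_iff_of_mem_cell hz i).symm.trans (mem_iff_of_mem_cell h i)

theorem isFace_iff (hk : 0 < k) {F : Set (Fin n → ℝ)} :
    IsFace n k F ↔ F = ∅ ∨ ∃ a I, IsCell k a I ∧ F = cell k a I := by
  refine or_congr Iff.rfl ⟨?_, ?_⟩
  · rintro ⟨y, hy, rfl⟩
    have h := mem_cell_floor hk hy
    exact ⟨_, _, isCell_of_mem h, openCell_eq_cell hk h⟩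
  · rintro ⟨a, I, h, rfl⟩
    obtain ⟨y, hy⟩ := h.nonempty
    exact ⟨y, (mem_newtonPolytope hk).2 ⟨apply_nonneg_of_mem_cell hy, hy.2.2⟩,
      (openCell_eq_cell hk hy).symm⟩

/-! ### Dimension -/

/-- Moving a point of a cell a little in the direction `e_i - e_j`. -/
theorem exists_move_mem_cell {a : Fin n → ℕ} {I : Finset (Fin n)} {y : Fin n → ℝ}
    (hy : y ∈ cell k a I) {i j : Fin n} (hi : i ∈ I) (hj : j ∈ I) (hij : i ≠ j) :
    ∃ t : ℝ, 0 < t ∧ y + t • (Pi.single i 1 - Pi.single j 1) ∈ cell k a I := by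
  have h1 := hy.1 i hi
  have h2 := hy.1 j hj
  refine ⟨min (a i + 1 - y i) (y j - a j) / 2, ?_, fun l hl => ?_, fun l hl => ?_, ?_⟩
  · have : 0 < min (a i + 1 - y i) (y j - a j) := lt_min (by linarith) (by linarith)
    linarith
  · have h0 : 0 < min (a i + 1 - y i) (y j - a j) := lt_min (by linarith) (by linarith)
    have h3 := min_le_left (a i + 1 - y i) (y j - a j)
    have h4 := min_le_right (a i + 1 - y i) (y j - a j)
    have hl' := hy.1 l hl
    rcases eq_or_ne l i with rfl | hli
    · simp only [Pi.add_apply, Pi.smul_apply, Pi.sub_apply, Pi.single_eq_same,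
        Pi.single_eq_of_ne hij, smul_eq_mul]
      constructor <;> linarith
    · rcases eq_or_ne l j with rfl | hlj
      · simp only [Pi.add_apply, Pi.smul_apply, Pi.sub_apply, Pi.single_eq_same,
          Pi.single_eq_of_ne hli, smul_eq_mul]
        constructor <;> linarith
      · simpa [hli, hlj] using hl'
  · have hli : l ≠ i := fun h => hl (h ▸ hi)
    have hlj : l ≠ j := fun h => hl (h ▸ hj)
    simpa [hli, hlj] using hy.2.1 l hl
  · simp [Finset.sum_add_distrib, ← Finset.mul_sum, hy.2.2]

/-- Differences of points vanish off `I` and have coordinate sum zero; conversely a small move along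
e_i - e_j stays in the open cell. -/
theorem vectorSpan_cell {a : Fin n → ℕ} {I : Finset (Fin n)} (h : IsCell k a I) {j : Fin n}
    (hj : j ∈ I) : vectorSpan ℝ (cell k a I) = Submodule.span ℝ
      (Set.range fun i : {i // i ∈ I.erase j} =>
        (Pi.single i.1 1 - Pi.single j 1 : Fin n → ℝ)) := by
  apply le_antisymm
  · rw [vectorSpan_def, Submodule.span_le]
    rintro _ ⟨y, hy, z, hz, rfl⟩
    have hv : y - z = ∑ i : {i // i ∈ I.erase j}, (y i.1 - z i.1) •
        (Pi.single i.1 1 - Pi.single j 1 : Fin n → ℝ) := by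
      refine Eq.trans ?_ (Finset.sum_coe_sort (I.erase j) fun i => (y i - z i) •
        (Pi.single i 1 - Pi.single j 1 : Fin n → ℝ)).symm
      have hoff : ∀ i ∉ I, y i - z i = 0 := fun i hi => by
        rw [hy.2.1 i hi, hz.2.1 i hi, sub_self]
      have hsum : ∑ i ∈ I.erase j, (y i - z i) = -(y j - z j) := by
        have h1 : ∑ i ∈ I, (y i - z i) = ∑ i, (y i - z i) :=
          Finset.sum_subset (Finset.subset_univ _) fun i _ hi => hoff i hi
        have h2 : ∑ i, (y i - z i) = 0 := by
          rw [Finset.sum_sub_distrib, hy.2.2, hz.2.2, sub_self]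
        rw [h2, ← Finset.add_sum_erase I _ hj] at h1
        linarith
      ext l
      simp only [Finset.sum_apply, Pi.smul_apply, Pi.sub_apply, smul_eq_mul, mul_sub,
        Finset.sum_sub_distrib, ← Finset.sum_mul, hsum]
      rcases eq_or_ne l j with rfl | hlj
      · rw [Finset.sum_eq_zero]
        · simp
        · intro i hi
          rw [Pi.single_eq_of_ne (Finset.ne_of_mem_erase hi).symm, mul_zero]
      · rw [Pi.single_eq_of_ne hlj, mul_zero, sub_zero]
        by_cases hl : l ∈ I
        · rw [Finset.sum_eq_single_of_mem l (Finset.mem_erase.2 ⟨hlj, hl⟩)]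
          · simp
          · intro i _ hil
            rw [Pi.single_eq_of_ne hil.symm, mul_zero]
        · rw [hoff l hl, Finset.sum_eq_zero]
          intro i hi
          rw [Pi.single_eq_of_ne, mul_zero]
          rintro rfl
          exact hl (Finset.mem_of_mem_erase hi)
    change y - z ∈ Submodule.span ℝ _
    rw [hv]
    exact Submodule.sum_mem _ fun i _ => Submodule.smul_mem _ _
      (Submodule.subset_span (Set.mem_range_self i))
  · rw [Submodule.span_le]
    rintro _ ⟨⟨i, hi⟩, rfl⟩
    obtain ⟨y, hy⟩ := h.nonempty
    obtain ⟨t, ht, hmem⟩ := exists_move_mem_cell hy (Finset.mem_of_mem_erase hi) hj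
      (Finset.ne_of_mem_erase hi)
    have := vsub_mem_vectorSpan ℝ hmem hy
    rw [vsub_eq_sub, add_sub_cancel_left] at this
    exact (Submodule.smul_mem_iff _ ht.ne').1 this

theorem rank_cell {a : Fin n → ℕ} {I : Finset (Fin n)} (h : IsCell k a I) :
    rank (cell k a I) = if I = ∅ then 1 else I.card := by
  rw [rank, if_neg h.nonempty.ne_empty]
  split_ifs with hI
  · subst hI
    have hsub : (cell k a ∅).Subsingleton := fun y hy z hz => funext fun i => by
      rw [hy.2.1 i (by simp), hz.2.1 i (by simp)]
    rw [vectorSpan_of_subsingleton ℝ hsub, finrank_bot]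
  · obtain ⟨j, hj⟩ := Finset.nonempty_of_ne_empty hI
    rw [vectorSpan_cell h hj, finrank_span_eq_card]
    · rw [Fintype.card_coe, Finset.card_erase_add_one hj]
    · rw [Fintype.linearIndependent_iff]
      intro g hg i
      have := congrFun hg i.1
      simp only [Finset.sum_apply, Pi.smul_apply, Pi.sub_apply, smul_eq_mul,
        Pi.single_eq_of_ne (Finset.ne_of_mem_erase i.2), sub_zero, Pi.zero_apply] at this
      rw [Finset.sum_eq_single i] at this
      · simpa using this
      · intro b _ hb
        rw [Pi.single_eq_of_ne fun h => hb (Subtype.ext h.symm), mul_zero]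
      · simp

/-! ### Closure, labels and moving coordinates -/

theorem mem_closure_cell {a : Fin n → ℕ} {I : Finset (Fin n)} (h : IsCell k a I)
    {y : Fin n → ℝ} : y ∈ closure (cell k a I) ↔
      (∀ i ∈ I, (a i : ℝ) ≤ y i ∧ y i ≤ a i + 1) ∧ (∀ i ∉ I, y i = a i) ∧ ∑ i, y i = k := by
  constructor
  · intro hy
    have hcl : IsClosed {y : Fin n → ℝ | (∀ i ∈ I, (a i : ℝ) ≤ y i ∧ y i ≤ a i + 1) ∧
        (∀ i ∉ I, y i = a i) ∧ ∑ i, y i = k} := by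
      simp only [Set.ofPred_and, Set.ofPred_forall]
      refine IsClosed.inter ?_ (IsClosed.inter ?_ ?_)
      · exact isClosed_biInter fun i _ => (isClosed_le (by fun_prop) (by fun_prop)).inter
          (isClosed_le (by fun_prop) (by fun_prop))
      · exact isClosed_biInter fun i _ => isClosed_eq (by fun_prop) (by fun_prop)
      · exact isClosed_eq (by fun_prop) (by fun_prop)
    refine closure_minimal ?_ hcl hy
    exact fun z hz => ⟨fun i hi => ⟨(hz.1 i hi).1.le, (hz.1 i hi).2.le⟩, hz.2.1, hz.2.2⟩
  · rintro ⟨h1, h2, h3⟩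
    obtain ⟨z, hz⟩ := h.nonempty
    -- The segment from y to a point of the open cell lies in the open cell except possibly at y,
    -- and y is a limit of it.
    have hseg : openSegment ℝ y z ⊆ cell k a I := by
      rintro _ ⟨s, t, hs, ht, hst, rfl⟩
      obtain rfl : s = 1 - t := by linarith
      refine ⟨fun i hi => ?_, fun i hi => ?_, ?_⟩
      · have hy := h1 i hi
        have hz := hz.1 i hi
        simp only [Pi.add_apply, Pi.smul_apply, smul_eq_mul]
        constructor <;> nlinarith
      · simp only [Pi.add_apply, Pi.smul_apply, smul_eq_mul, h2 i hi, hz.2.1 i hi]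
        ring
      · simp only [Pi.add_apply, Pi.smul_apply, smul_eq_mul, Finset.sum_add_distrib,
          ← Finset.mul_sum, h3, hz.2.2]
        ring
    refine closure_mono hseg ?_
    rw [closure_openSegment]
    exact left_mem_segment ℝ y z

/-- A single point of the smaller cell is enough: strict inequalities between a non-integral
coordinate and integers force the inequalities between the corners. -/
theorem cell_subset_closure_iff {a a' : Fin n → ℕ} {I I' : Finset (Fin n)} (h : IsCell k a I)
    (h' : IsCell k a' I') : cell k a' I' ⊆ closure (cell k a I) ↔
      I' ⊆ I ∧ ∀ i, (i ∈ I' → a' i = a i) ∧ (i ∈ I → a i ≤ a' i ∧ a' i ≤ a i + 1) ∧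
        (i ∉ I → a' i = a i) := by
  constructor
  · intro hs
    obtain ⟨y, hy⟩ := h'.nonempty
    obtain ⟨h1, h2, -⟩ := (mem_closure_cell h).1 (hs hy)
    have hI : I' ⊆ I := by
      intro i hi
      by_contra hni
      have e := hy.1 i hi
      rw [h2 i hni] at e
      have e1 : a' i < a i := by exact_mod_cast e.1
      have e2 : a i < a' i + 1 := by exact_mod_cast e.2
      omega
    refine ⟨hI, fun i => ⟨fun hi => ?_, fun hi => ?_, fun hi => ?_⟩⟩
    · have e := hy.1 i hi
      have e' := h1 i (hI hi)
      have e1 : a' i < a i + 1 := by exact_mod_cast e.1.trans_le e'.2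
      have e2 : a i < a' i + 1 := by exact_mod_cast e'.1.trans_lt e.2
      omega
    · have e' := h1 i hi
      by_cases hi' : i ∈ I'
      · have e := hy.1 i hi'
        have e1 : a' i < a i + 1 := by exact_mod_cast e.1.trans_le e'.2
        have e2 : a i < a' i + 1 := by exact_mod_cast e'.1.trans_lt e.2
        omega
      · rw [hy.2.1 i hi'] at e'
        exact_mod_cast e'
    · have e := h2 i hi
      rw [hy.2.1 i fun h => hi (hI h)] at e
      exact_mod_cast e
  · rintro ⟨hI, hs⟩ y hy
    rw [mem_closure_cell h]
    refine ⟨fun i hi => ?_, fun i hi => ?_, hy.2.2⟩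
    · by_cases hi' : i ∈ I'
      · have := hy.1 i hi'
        rw [(hs i).1 hi'] at this
        exact ⟨this.1.le, this.2.le⟩
      · rw [hy.2.1 i hi']
        exact_mod_cast (hs i).2.1 hi
    · rw [hy.2.1 i fun h => hi (hI h), (hs i).2.2 hi]

theorem point_mem_closure_cell {a : Fin n → ℕ} {I : Finset (Fin n)} (h : IsCell k a I)
    {v : Fin n →₀ ℕ} : point v ∈ closure (cell k a I) ↔
      (∀ i ∈ I, a i ≤ v i ∧ v i ≤ a i + 1) ∧ (∀ i ∉ I, v i = a i) ∧ ∑ i, v i = k := by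
  rw [mem_closure_cell h]
  simp only [point]
  norm_cast

theorem exists_vertex_apply {a : Fin n → ℕ} {I : Finset (Fin n)} (h : IsCell k a I) {i : Fin n}
    (hi : i ∈ I) : ∃ v : Fin n →₀ ℕ, v ∈ exponents n k ∧ point v ∈ closure (cell k a I) ∧
      v i = a i + 1 := by
  have h' : ∑ i, a i < k ∧ k < ∑ i, a i + I.card := by
    rcases h with ⟨rfl, _⟩ | h
    · simp at hi
    · exact h
  -- The vertices of a hypersimplex raise exactly k - |a| coordinates of `I`; as this number is at
  -- least 1, the given i can be among them.
  obtain ⟨J, hJ1, hJ2, hJ3⟩ := Finset.exists_subsuperset_card_eq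
    (Finset.singleton_subset_iff.2 hi) (n := k - ∑ i, a i)
    (by rw [Finset.card_singleton]; omega) (by omega)
  have hs : ∑ l, (a l + if l ∈ J then 1 else 0) = k := by
    rw [Finset.sum_add_distrib]
    simp only [Finset.sum_ite_mem, Finset.univ_inter, Finset.sum_const, smul_eq_mul, mul_one]
    omega
  refine ⟨Finsupp.equivFunOnFinite.symm fun l => a l + if l ∈ J then 1 else 0, ?_, ?_, ?_⟩
  · rw [sum_eq_of_mem_exponents]
    simpa using hs
  · rw [point_mem_closure_cell h]
    refine ⟨fun l _ => ?_, fun l hl => ?_, by simpa using hs⟩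
    · simp only [Finsupp.equivFunOnFinite_symm_apply_apply]
      split_ifs <;> omega
    · have : l ∉ J := fun hl' => hl (hJ2 hl')
      simp [this]
  · have : i ∈ J := hJ1 (by simp)
    simp [this]

theorem label_apply_of_eq {F : Face n k p} {a : Fin n → ℕ} {I : Finset (Fin n)}
    (h : IsCell k a I) (hF : F.1 = cell k a I) (i : Fin n) :
    label F i = a i + if i ∈ I then 1 else 0 := by
  classical
  rw [label, hF]
  apply le_antisymm
  · let b : Fin n →₀ ℕ := Finsupp.equivFunOnFinite.symm fun i => a i + if i ∈ I then 1 else 0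
    have hle : ((exponents n k).filter fun v => point v ∈ closure (cell k a I)).sup id ≤ b := by
      refine Finset.sup_le fun v hv => ?_
      obtain ⟨h1, h2, -⟩ := (point_mem_closure_cell h).1 (Finset.mem_filter.1 hv).2
      intro j
      change v j ≤ a j + if j ∈ I then 1 else 0
      split_ifs with hj
      · exact (h1 j hj).2
      · exact (h2 j hj).le
    exact hle i
  · have hge : ∀ v : Fin n →₀ ℕ, v ∈ exponents n k → point v ∈ closure (cell k a I) →
        v i ≤ ((exponents n k).filter fun v => point v ∈ closure (cell k a I)).sup id i :=
      fun v hv hv' => (Finset.le_sup (f := id) (Finset.mem_filter.2 ⟨hv, hv'⟩) :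
        v ≤ ((exponents n k).filter fun v => point v ∈ closure (cell k a I)).sup id) i
    split_ifs with hi
    · obtain ⟨v, hv, hv', he⟩ := exists_vertex_apply h hi
      rw [← he]
      exact hge v hv hv'
    · rcases I.eq_empty_or_nonempty with rfl | ⟨j, hj⟩
      · have hs : ∑ i, a i = k := by
          rcases h with h | h
          · exact h.2
          · simp at h
            omega
        have := hge (Finsupp.equivFunOnFinite.symm a)
          (by rw [sum_eq_of_mem_exponents]; simpa using hs)
          (by rw [point_mem_closure_cell h]; simpa using hs)
        rw [add_zero]
        exact this
      · obtain ⟨v, hv, hv', -⟩ := exists_vertex_apply h hj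
        have := hge v hv hv'
        rw [((point_mem_closure_cell h).1 hv').2.1 i hi] at this
        rw [add_zero]
        exact this

/-- A nonempty `I` has at least two elements, so each of its coordinates can be varied against
another one. -/
theorem moving_of_eq {F : Face n k p} {a : Fin n → ℕ} {I : Finset (Fin n)}
    (h : IsCell k a I) (hF : F.1 = cell k a I) : moving F = I := by
  classical
  ext i
  rw [moving, hF, Finset.mem_filter]
  constructor
  · rintro ⟨-, y, hy, z, hz, hne⟩
    by_contra hi
    exact hne (by rw [hy.2.1 i hi, hz.2.1 i hi])
  · intro hi
    obtain ⟨j, hj, hij⟩ := Finset.exists_mem_ne (h.two_le_card ⟨i, hi⟩) i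
    obtain ⟨y, hy⟩ := h.nonempty
    obtain ⟨t, ht, hm⟩ := exists_move_mem_cell hy hi hj hij.symm
    refine ⟨Finset.mem_univ i, _, hm, y, hy, ?_⟩
    simp [hij.symm, ht.ne']

end SubdividedSimplex

namespace SubdividedSimplex
variable {n k p q : ℕ}

/-! ## Faces in coordinates -/

/-- The rank of a cell with moving coordinates `I`. -/
def cellRank (I : Finset (Fin n)) : ℕ := if I = ∅ then 1 else I.card

/-- The lower corner of a face. -/
noncomputable def corner (F : Face n k p) : Fin n → ℕ :=
  fun i => label F i - if i ∈ moving F then 1 else 0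

theorem corner_of_eq {F : Face n k p} {a : Fin n → ℕ} {I : Finset (Fin n)}
    (h : IsCell k a I) (hF : F.1 = cell k a I) : corner F = a := by
  ext i
  rw [corner, label_apply_of_eq h hF, moving_of_eq h hF, Nat.add_sub_cancel]

theorem Face.spec (hk : 0 < k) (F : Face n k (p + 1)) :
    IsCell k (corner F) (moving F) ∧ F.1 = cell k (corner F) (moving F) ∧
      cellRank (moving F) = p + 1 := by
  rcases (isFace_iff hk).1 F.2.1 with h | ⟨a, I, h, hF⟩
  · have := F.2.2
    rw [h] at this
    simp [rank] at this
  · rw [corner_of_eq h hF, moving_of_eq h hF]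
    refine ⟨h, hF, ?_⟩
    rw [← F.2.2, hF, rank_cell h, cellRank]

theorem Face.isCell (hk : 0 < k) (F : Face n k (p + 1)) : IsCell k (corner F) (moving F) :=
  (F.spec hk).1

theorem Face.eq_cell (hk : 0 < k) (F : Face n k (p + 1)) :
    F.1 = cell k (corner F) (moving F) :=
  (F.spec hk).2.1

theorem Face.ext_corner (hk : 0 < k) {F G : Face n k (p + 1)} (hc : corner F = corner G)
    (hm : moving F = moving G) : F = G :=
  Subtype.ext (by rw [F.eq_cell hk, G.eq_cell hk, hc, hm])

theorem label_apply (hk : 0 < k) (F : Face n k (p + 1)) (i : Fin n) :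
    label F i = corner F i + if i ∈ moving F then 1 else 0 :=
  label_apply_of_eq (F.isCell hk) (F.eq_cell hk) i

/-- The face with given lower corner and moving coordinates. -/
def ofCell (hk : 0 < k) {a : Fin n → ℕ} {I : Finset (Fin n)} (h : IsCell k a I)
    (hp : cellRank I = p) : Face n k p :=
  ⟨cell k a I, (isFace_iff hk).2 (Or.inr ⟨a, I, h, rfl⟩), by rw [rank_cell h]; exact hp⟩

theorem corner_ofCell (hk : 0 < k) {a : Fin n → ℕ} {I : Finset (Fin n)} (h : IsCell k a I)
    (hp : cellRank I = p) : corner (ofCell hk h hp) = a :=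
  corner_of_eq h rfl

theorem moving_ofCell (hk : 0 < k) {a : Fin n → ℕ} {I : Finset (Fin n)} (h : IsCell k a I)
    (hp : cellRank I = p) : moving (ofCell hk h hp) = I :=
  moving_of_eq h rfl

theorem moving_vertex (hk : 0 < k) (F : Face n k 1) : moving F = ∅ := by
  by_contra h
  have h1 := (F.isCell hk).two_le_card (Finset.nonempty_of_ne_empty h)
  have h2 := (F.spec hk).2.2
  rw [cellRank, if_neg h] at h2
  omega

theorem card_moving (hk : 0 < k) (F : Face n k (p + 2)) : (moving F).card = p + 2 := by
  have h2 := (F.spec hk).2.2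
  rw [cellRank] at h2
  split_ifs at h2 with h
  · omega
  · exact h2

theorem sum_corner_vertex (hk : 0 < k) (F : Face n k 1) : ∑ i, corner F i = k := by
  rcases F.isCell hk with h | h
  · exact h.2
  · rw [moving_vertex hk] at h
    simp at h
    omega

theorem sum_corner_lt (hk : 0 < k) (F : Face n k (p + 2)) :
    ∑ i, corner F i < k ∧ k < ∑ i, corner F i + (p + 2) := by
  rcases F.isCell hk with h | h
  · have := card_moving hk F
    rw [h.1] at this
    simp at this
  · rwa [card_moving hk] at h

theorem Face.eq_emptyFace (F : Face n k 0) : F = emptyFace n k := by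
  have h := F.2.2
  rw [rank] at h
  split_ifs at h with h'
  exact Subtype.ext h'

theorem label_of_empty (F : Face n k 0) : label F = 0 := by
  classical
  rw [F.eq_emptyFace, label, Finset.filter_false_of_mem]
  · rfl
  · intro a _
    simp [emptyFace]

/-! ## Facets -/

theorem subset_closure_iff (hk : 0 < k) {G : Face n k (q + 1)} {F : Face n k (p + 1)} :
    G.1 ⊆ closure F.1 ↔ moving G ⊆ moving F ∧ ∀ i, (i ∈ moving G → corner G i = corner F i) ∧
      (i ∈ moving F → corner F i ≤ corner G i ∧ corner G i ≤ corner F i + 1) ∧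
        (i ∉ moving F → corner G i = corner F i) := by
  rw [← cell_subset_closure_iff (F.isCell hk) (G.isCell hk), ← F.eq_cell hk, ← G.eq_cell hk]

theorem label_le_of_subset (hk : 0 < k) {G : Face n k (q + 1)} {F : Face n k (p + 1)}
    (h : G.1 ⊆ closure F.1) : label G ≤ label F := by
  obtain ⟨hm, hc⟩ := (subset_closure_iff hk).1 h
  intro i
  rw [label_apply hk, label_apply hk]
  obtain ⟨h1, h2, h3⟩ := hc i
  by_cases hF : i ∈ moving F
  · by_cases hG : i ∈ moving G
    · simp [hF, hG, h1 hG]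
    · simp [hF, hG, (h2 hF).2]
  · have hG : i ∉ moving G := fun h => hF (hm h)
    simp [hF, hG, h3 hF]

/-- The ranks start at 2 because the vertices of an edge are different: there both coordinates stop
moving at once. -/
theorem exists_moving_eq_erase (hk : 0 < k) {G : Face n k (p + 2)} {F : Face n k (p + 3)}
    (h : G.1 ⊆ closure F.1) : ∃ j ∈ moving F, moving G = (moving F).erase j := by
  have hm := ((subset_closure_iff hk).1 h).1
  have hc : (moving F \ moving G).card = 1 := by
    rw [Finset.card_sdiff_of_subset hm, card_moving hk F, card_moving hk G]
    omega
  obtain ⟨j, hj⟩ := Finset.card_eq_one.1 hc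
  have hj' : j ∈ moving F \ moving G := by rw [hj]; simp
  refine ⟨j, (Finset.mem_sdiff.1 hj').1, ?_⟩
  rw [Finset.erase_eq, ← hj, Finset.sdiff_sdiff_eq_self hm]

/-! ## Incidence numbers -/

/-- This makes incidence numbers units, hence nonzero in a field of any characteristic. -/
theorem incidence_sq (G : Face n k q) (F : Face n k p) : incidence G F ^ 2 = 1 := by
  rw [incidence]
  split_ifs <;> simp [← pow_mul, mul_comm _ 2]

/-- It turns the geometric test for "lower bound" in `incidence` into an equation between corners.
-/
theorem forall_le_iff (hk : 0 < k) {G : Face n k (q + 1)} {F : Face n k (p + 1)}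
    (h : G.1 ⊆ closure F.1) {j : Fin n} (hj : j ∈ moving F) (hj' : j ∉ moving G) :
    (∀ y ∈ G.1, ∀ z ∈ F.1, y j ≤ z j) ↔ corner G j = corner F j := by
  have hc := (((subset_closure_iff hk).1 h).2 j).2.1 hj
  constructor
  · intro h'
    obtain ⟨y, hy⟩ := (G.isCell hk).nonempty
    obtain ⟨z, hz⟩ := (F.isCell hk).nonempty
    have h1 := h' y (by rwa [G.eq_cell hk]) z (by rwa [F.eq_cell hk])
    rw [hy.2.1 j hj'] at h1
    have h2 : corner G j < corner F j + 1 := by exact_mod_cast h1.trans_lt (hz.1 j hj).2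
    omega
  · intro he y hy z hz
    rw [G.eq_cell hk] at hy
    rw [F.eq_cell hk] at hz
    rw [hy.2.1 j hj', he]
    exact (hz.1 j hj).1.le

/-- The number of elements of `I` below `j`, as a sign. -/
def posSign (I : Finset (Fin n)) (j : Fin n) : ℤ := (-1) ^ (I.filter fun i => i < j).card

theorem posSign_erase {I : Finset (Fin n)} {i : Fin n} (hi : i ∈ I) (j : Fin n) :
    posSign I j = posSign (I.erase i) j * if i < j then -1 else 1 := by
  rw [posSign, posSign, Finset.filter_erase]
  split_ifs with h
  · rw [← Finset.card_erase_add_one (a := i) (by simp [hi, h]), pow_succ]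
  · rw [Finset.erase_eq_of_notMem (by simp [h]), mul_one]

theorem posSign_eq_one_of_min {I : Finset (Fin n)} {j : Fin n} (h : ∀ i ∈ I, j ≤ i) :
    posSign I j = 1 := by
  rw [posSign, Finset.filter_false_of_mem fun i hi => (h i hi).not_gt]
  simp

theorem incidence_eq (hk : 0 < k) {G : Face n k (q + 1)} {F : Face n k (p + 1)}
    (h : G.1 ⊆ closure F.1) {j : Fin n} (hj : j ∈ moving F) (hj' : j ∉ moving G)
    (hmin : ∀ i ∈ moving F \ moving G, j ≤ i) :
    incidence G F = posSign (moving F) j * if corner G j = corner F j then 1 else -1 := by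
  classical
  have hjs : j ∈ moving F \ moving G := Finset.mem_sdiff.2 ⟨hj, hj'⟩
  have hm : (moving F \ moving G).min' ⟨j, hjs⟩ = j :=
    le_antisymm (Finset.min'_le _ _ hjs) (hmin _ (Finset.min'_mem _ _))
  rw [incidence, dif_pos ⟨j, hjs⟩]
  simp only [hm, forall_le_iff hk h hj hj']
  rw [posSign]

theorem incidence_of_erase (hk : 0 < k) {G : Face n k (q + 1)} {F : Face n k (p + 1)}
    (h : G.1 ⊆ closure F.1) {j : Fin n} (hj : j ∈ moving F)
    (hG : moving G = (moving F).erase j) :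
    incidence G F = posSign (moving F) j * if corner G j = corner F j then 1 else -1 := by
  refine incidence_eq hk h hj (by simp [hG]) fun i hi => ?_
  simp only [hG, Finset.mem_sdiff, Finset.mem_erase, not_and, not_imp_not] at hi
  exact (hi.2 hi.1).ge

theorem incidence_vertex (hk : 0 < k) {G : Face n k 1} {F : Face n k (p + 2)}
    (h : G.1 ⊆ closure F.1) {j : Fin n} (hj : j ∈ moving F) (hmin : ∀ i ∈ moving F, j ≤ i) :
    incidence G F = if corner G j = corner F j then 1 else -1 := by
  rw [incidence_eq hk h hj (by simp [moving_vertex hk]) fun i hi =>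
    hmin i (Finset.mem_sdiff.1 hi).1, posSign_eq_one_of_min hmin, one_mul]

theorem incidence_empty (hk : 0 < k) (G : Face n k 0) (F : Face n k 1) : incidence G F = 1 := by
  rw [incidence, dif_neg]
  rw [moving_vertex hk]
  simp

open Classical in
/-- The matrix of incidence numbers, extended by zero to pairs that are not incident. -/
noncomputable def inc (G : Face n k p) (F : Face n k q) : ℤ :=
  if G.1 ⊆ closure F.1 then incidence G F else 0

theorem inc_ne_zero_iff {G : Face n k p} {F : Face n k q} :
    inc G F ≠ 0 ↔ G.1 ⊆ closure F.1 := by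
  rw [inc]
  split_ifs with h
  · simp only [h, iff_true]
    intro h0
    have := incidence_sq G F
    rw [h0] at this
    simp at this
  · simp [h]

theorem inc_cast_ne_zero_iff {K : Type*} [Field K] {G : Face n k p} {F : Face n k q} :
    (inc G F : K) ≠ 0 ↔ G.1 ⊆ closure F.1 := by
  rw [inc]
  split_ifs with h
  · simp only [h, iff_true]
    intro h0
    have : ((incidence G F : ℤ) : K) ^ 2 = 1 := by
      rw [← Int.cast_pow, incidence_sq, Int.cast_one]
    rw [h0] at this
    simp at this
  · simp [h]

theorem inc_of_subset {G : Face n k p} {F : Face n k q} (h : G.1 ⊆ closure F.1) :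
    inc G F = incidence G F := if_pos h

end SubdividedSimplex

namespace SubdividedSimplex
variable {n k p q r : ℕ}

/-! ## The boundary of a boundary -/

theorem subset_closure_trans {H : Face n k r} {G : Face n k q} {F : Face n k p}
    (h : H.1 ⊆ closure G.1) (h' : G.1 ⊆ closure F.1) : H.1 ⊆ closure F.1 :=
  h.trans (closure_minimal h' isClosed_closure)

theorem sum_add_sum_of_eq_off {a c : Fin n → ℕ} {I : Finset (Fin n)}
    (h : ∀ i ∉ I, c i = a i) : ∑ i, c i + ∑ i ∈ I, a i = ∑ i, a i + ∑ i ∈ I, c i := by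
  rw [← Finset.sum_add_sum_compl I c, ← Finset.sum_add_sum_compl I a,
    Finset.sum_congr rfl fun i hi => h i (Finset.mem_compl.1 hi)]
  ring

/-- An intermediate cell is determined by its moving set, so counting intermediate cells is counting
sets of coordinates. -/
theorem corner_eq_of_between (hk : 0 < k) {H : Face n k (r + 1)} {G : Face n k (q + 1)}
    {F : Face n k (p + 1)} (h : H.1 ⊆ closure G.1) (h' : G.1 ⊆ closure F.1) (i : Fin n) :
    corner G i = if i ∈ moving G then corner F i else corner H i := by
  split_ifs with hi
  · exact (((subset_closure_iff hk).1 h').2 i).1 hi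
  · exact ((((subset_closure_iff hk).1 h).2 i).2.2 hi).symm

theorem between_of_corner_eq (hk : 0 < k) {H : Face n k (r + 1)} {G : Face n k (q + 1)}
    {F : Face n k (p + 1)} (h : H.1 ⊆ closure F.1) (h1 : moving H ⊆ moving G)
    (h2 : moving G ⊆ moving F)
    (hc : ∀ i, corner G i = if i ∈ moving G then corner F i else corner H i) :
    H.1 ⊆ closure G.1 ∧ G.1 ⊆ closure F.1 := by
  obtain ⟨hm, hF⟩ := (subset_closure_iff hk).1 h
  rw [subset_closure_iff hk, subset_closure_iff hk]
  refine ⟨⟨h1, fun i => ?_⟩, ⟨h2, fun i => ?_⟩⟩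
  · have hi := hF i
    have := @h1 i
    have := @h2 i
    rw [hc i]
    split_ifs <;> simp_all
  · have hi := hF i
    have := @h1 i
    have := @h2 i
    rw [hc i]
    split_ifs <;> simp_all

theorem sum_inc_mul_inc_of_two (hk : 0 < k) {H : Face n k (r + 1)} {G₁ G₂ : Face n k (q + 1)}
    {F : Face n k (p + 1)} (h₁ : H.1 ⊆ closure G₁.1) (h₁' : G₁.1 ⊆ closure F.1)
    (h₂ : H.1 ⊆ closure G₂.1) (h₂' : G₂.1 ⊆ closure F.1) (hne : moving G₁ ≠ moving G₂)
    (hall : ∀ G : Face n k (q + 1), H.1 ⊆ closure G.1 → G.1 ⊆ closure F.1 →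
      moving G = moving G₁ ∨ moving G = moving G₂)
    (hs : inc H G₁ * inc G₁ F + inc H G₂ * inc G₂ F = 0) :
    ∑ G : Face n k (q + 1), inc H G * inc G F = 0 := by
  rw [Fintype.sum_eq_add G₁ G₂ (fun h => hne (by rw [h])), hs]
  rintro G ⟨hG₁, hG₂⟩
  by_contra h0
  have hH := inc_ne_zero_iff.1 (left_ne_zero_of_mul h0)
  have hF := inc_ne_zero_iff.1 (right_ne_zero_of_mul h0)
  rcases hall G hH hF with hm | hm
  · refine hG₁ (Face.ext_corner hk (funext fun i => ?_) hm)
    rw [corner_eq_of_between hk hH hF, corner_eq_of_between hk h₁ h₁', hm]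
  · refine hG₂ (Face.ext_corner hk (funext fun i => ?_) hm)
    rw [corner_eq_of_between hk hH hF, corner_eq_of_between hk h₂ h₂', hm]

theorem sum_inc_mul_inc_of_not_subset {H : Face n k r} {F : Face n k p}
    (h : ¬ H.1 ⊆ closure F.1) : ∑ G : Face n k q, inc H G * inc G F = 0 := by
  refine Finset.sum_eq_zero fun G _ => ?_
  by_contra h0
  exact h (subset_closure_trans (inc_ne_zero_iff.1 (left_ne_zero_of_mul h0))
    (inc_ne_zero_iff.1 (right_ne_zero_of_mul h0)))

theorem exists_lt_of_card_eq_two {I : Finset (Fin n)} (h : I.card = 2) :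
    ∃ i j, i < j ∧ I = {i, j} := by
  obtain ⟨i, j, hij, rfl⟩ := Finset.card_eq_two.1 h
  rcases lt_or_gt_of_ne hij with h | h
  · exact ⟨i, j, h, rfl⟩
  · exact ⟨j, i, h, Finset.pair_comm _ _⟩

/-- An edge with corner a and moving coordinates i < j has the ends a + e_i and a + e_j; coordinate
i is at its upper bound at one and at its lower bound at the other, so the signs cancel. -/
theorem sum_inc_mul_inc_empty (hk : 0 < k) (H : Face n k 0) (F : Face n k 2) :
    ∑ G : Face n k 1, inc H G * inc G F = 0 := by
  have hH : ∀ G : Face n k 1, inc H G = 1 := fun G => by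
    rw [inc_of_subset, incidence_empty hk]
    rw [H.eq_emptyFace]
    exact Set.empty_subset _
  simp only [hH, one_mul]
  obtain ⟨i, j, hij, hm⟩ := exists_lt_of_card_eq_two (card_moving hk F)
  have hs := sum_corner_lt hk F
  have hsum : ∀ l, ∑ m, (corner F m + if m = l then 1 else 0) = ∑ m, corner F m + 1 :=
    fun l => by simp [Finset.sum_add_distrib]
  have hcell : ∀ l, IsCell k (fun m => corner F m + if m = l then 1 else 0) ∅ := fun l =>
    Or.inl ⟨rfl, by rw [hsum]; omega⟩
  let G : Fin n → Face n k 1 := fun l => ofCell hk (hcell l) rfl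
  have hGc : ∀ l m, corner (G l) m = corner F m + if m = l then 1 else 0 := fun l m =>
    congrFun (corner_ofCell hk (hcell l) rfl) m
  have hsub : ∀ l ∈ moving F, (G l).1 ⊆ closure F.1 := fun l hl => by
    rw [subset_closure_iff hk, moving_vertex hk]
    refine ⟨by simp, fun m => ⟨by simp, fun _ => ?_, fun hm => ?_⟩⟩
    · rw [hGc]; split_ifs <;> omega
    · rw [hGc, if_neg, add_zero]
      rintro rfl
      exact hm hl
  have hi : i ∈ moving F := by simp [hm]
  have hj : j ∈ moving F := by simp [hm]
  have hmin : ∀ l ∈ moving F, i ≤ l := by simp [hm, hij.le]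
  rw [Fintype.sum_eq_add (G i) (G j), inc_of_subset (hsub i hi), inc_of_subset (hsub j hj),
    incidence_vertex hk (hsub i hi) hi hmin, incidence_vertex hk (hsub j hj) hi hmin]
  · simp [hGc, hij.ne]
  · intro h
    have := congrFun (congrArg corner h) i
    rw [hGc, hGc] at this
    simp [hij.ne] at this
  · rintro V ⟨hVi, hVj⟩
    by_contra h0
    obtain ⟨-, hc⟩ := (subset_closure_iff hk).1 (inc_ne_zero_iff.1 h0)
    have h1 := sum_add_sum_of_eq_off (I := moving F) fun l => (hc l).2.2
    have h2 := (hc i).2.1 hi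
    have h3 := (hc j).2.1 hj
    rw [hm, Finset.sum_pair hij.ne, Finset.sum_pair hij.ne, sum_corner_vertex hk] at h1
    have key : ∀ l l', moving F = {l, l'} → l ≠ l' → corner V l = corner F l + 1 →
        corner V l' = corner F l' → V = G l := by
      intro l l' hm hne hl hl'
      refine Face.ext_corner hk (funext fun m => ?_) (by simp [moving_vertex hk])
      rw [hGc]
      by_cases hml : m = l
      · rw [if_pos hml, hml, hl]
      · rw [if_neg hml, add_zero]
        by_cases hml' : m = l'
        · rw [hml', hl']
        · exact (hc m).2.2 (by simp [hm, hml, hml'])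
    -- The corner of an edge has degree k - 1, so a vertex of it raises exactly one of the two
    -- coordinates.
    rcases Nat.eq_or_lt_of_le h2.1 with h4 | h4
    · exact hVj (key j i (by rw [hm, Finset.pair_comm]) hij.ne' (by omega) (by omega))
    · exact hVi (key i j hm hij.ne (by omega) (by omega))

/-- The candidate has lower degree at most, and upper degree at least, that of `H`, so it inherits
the strict inequalities of `H`. For a vertex `H` these are not strict, which is why that case is
treated separately. -/
theorem isCell_between (hk : 0 < k) {H : Face n k (r + 2)} {F : Face n k (p + 2)}
    (h : H.1 ⊆ closure F.1) {J : Finset (Fin n)} (h1 : moving H ⊆ J) (h2 : J ⊆ moving F) :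
    IsCell k (fun i => if i ∈ J then corner F i else corner H i) J := by
  obtain ⟨hm, hc⟩ := (subset_closure_iff hk).1 h
  have hs := sum_corner_lt hk H
  right
  constructor
  · refine lt_of_le_of_lt (Finset.sum_le_sum fun i _ => ?_) hs.1
    split_ifs with hi
    · exact ((hc i).2.1 (h2 hi)).1
    · exact le_rfl
  · have hle : ∑ i, (corner H i + if i ∈ moving H then 1 else 0) ≤
        ∑ i, ((if i ∈ J then corner F i else corner H i) + if i ∈ J then 1 else 0) := by
      refine Finset.sum_le_sum fun i _ => ?_
      have hi := hc i
      have := @h1 i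
      have := @h2 i
      by_cases hH : i ∈ moving H
      · simp_all
      · by_cases hJ : i ∈ J
        · simp_all
        · simp_all
    rw [Finset.sum_add_distrib, Finset.sum_add_distrib] at hle
    simp only [Finset.sum_ite_mem, Finset.univ_inter, Finset.sum_const, smul_eq_mul, mul_one,
      card_moving hk H] at hle
    beta_reduce
    omega

theorem sum_inc_mul_inc_high (hk : 0 < k) (H : Face n k (p + 2)) (F : Face n k (p + 4)) :
    ∑ G : Face n k (p + 3), inc H G * inc G F = 0 := by
  by_cases h : H.1 ⊆ closure F.1
  swap
  · exact sum_inc_mul_inc_of_not_subset h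
  have hm := ((subset_closure_iff hk).1 h).1
  obtain ⟨i, j, hij, hd⟩ := exists_lt_of_card_eq_two (I := moving F \ moving H) (by
    rw [Finset.card_sdiff_of_subset hm, card_moving hk, card_moving hk]; omega)
  have hi : i ∈ moving F \ moving H := by simp [hd]
  have hj : j ∈ moving F \ moving H := by simp [hd]
  rw [Finset.mem_sdiff] at hi hj
  have hsub : ∀ l, l ∉ moving H → moving H ⊆ (moving F).erase l := fun l hl =>
    Finset.subset_erase.2 ⟨hm, hl⟩
  have hcell : ∀ l, l ∉ moving H → IsCell k _ ((moving F).erase l) := fun l hl =>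
    isCell_between hk h (hsub l hl) (Finset.erase_subset _ _)
  have hcard : ∀ l ∈ moving F, cellRank ((moving F).erase l) = p + 3 := fun l hl => by
    have hc : ((moving F).erase l).card = p + 3 := by
      rw [Finset.card_erase_of_mem hl, card_moving hk]
      omega
    rw [cellRank, if_neg, hc]
    rw [← Finset.card_eq_zero, hc]
    omega
  let Gi : Face n k (p + 3) := ofCell hk (hcell i hi.2) (hcard i hi.1)
  let Gj : Face n k (p + 3) := ofCell hk (hcell j hj.2) (hcard j hj.1)
  have mi : moving Gi = (moving F).erase i := moving_ofCell _ _ _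
  have mj : moving Gj = (moving F).erase j := moving_ofCell _ _ _
  obtain ⟨hi1, hi2⟩ := between_of_corner_eq hk (G := Gi) h (mi ▸ hsub i hi.2)
    (mi ▸ Finset.erase_subset _ _) (fun l => by
    rw [mi]; exact congrFun (corner_ofCell _ _ _) l)
  obtain ⟨hj1, hj2⟩ := between_of_corner_eq hk (G := Gj) h (mj ▸ hsub j hj.2)
    (mj ▸ Finset.erase_subset _ _) (fun l => by
    rw [mj]; exact congrFun (corner_ofCell _ _ _) l)
  have hHm : moving H = ((moving F).erase i).erase j := by
    ext l
    have hl := Finset.ext_iff.1 hd l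
    have := @hm l
    simp only [Finset.mem_sdiff, Finset.mem_insert, Finset.mem_singleton, Finset.mem_erase] at *
    tauto
  refine sum_inc_mul_inc_of_two hk hi1 hi2 hj1 hj2 ?_ ?_ ?_
  · intro he
    rw [mi, mj] at he
    have : j ∈ (moving F).erase j := he ▸ Finset.mem_erase.2 ⟨hij.ne', hj.1⟩
    simp at this
  · intro G hHG hGF
    obtain ⟨l, hl, hGl⟩ := exists_moving_eq_erase hk hGF
    have hlH : l ∉ moving H := fun hl' => by
      have := ((subset_closure_iff hk).1 hHG).1 hl'
      simp [hGl] at this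
    have : l ∈ moving F \ moving H := Finset.mem_sdiff.2 ⟨hl, hlH⟩
    rw [hd, Finset.mem_insert, Finset.mem_singleton] at this
    rcases this with rfl | rfl
    · exact Or.inl (hGl.trans mi.symm)
    · exact Or.inr (hGl.trans mj.symm)
  · have ci : corner Gi j = corner F j := by
      rw [corner_eq_of_between hk hi1 hi2, if_pos]
      rw [mi, Finset.mem_erase]
      exact ⟨hij.ne', hj.1⟩
    have cj : corner Gj i = corner F i := by
      rw [corner_eq_of_between hk hj1 hj2, if_pos]
      rw [mj, Finset.mem_erase]
      exact ⟨hij.ne, hi.1⟩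
    have ci' : corner Gi i = corner H i := by
      rw [corner_eq_of_between hk hi1 hi2, if_neg]
      simp [mi]
    have cj' : corner Gj j = corner H j := by
      rw [corner_eq_of_between hk hj1 hj2, if_neg]
      simp [mj]
    -- As i < j, erasing i lowers the position of j by one, while erasing j leaves the position of i
    -- alone. The bound factors agree on both paths, so the products are opposite.
    rw [inc_of_subset hi1, inc_of_subset hi2, inc_of_subset hj1, inc_of_subset hj2,
      incidence_of_erase hk hi1 (j := j) (by simp [mi, hij.ne', hj.1]) (by rw [mi, hHm]),
      incidence_of_erase hk hi2 hi.1 mi,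
      incidence_of_erase hk hj1 (j := i) (by simp [mj, hij.ne, hi.1])
        (by rw [mj, hHm, Finset.erase_right_comm]),
      incidence_of_erase hk hj2 hj.1 mj, ci, cj, ci', cj', mi, mj,
      posSign_erase hi.1 j, if_pos hij, posSign_erase hj.1 i, if_neg hij.not_gt]
    ring

/-- The offsets c - a are 0 or 1 on three coordinates and add up to 1 or 2, so one coordinate d is
the odd one out. -/
theorem exists_split_of_triangle {I : Finset (Fin n)} {a c : Fin n → ℕ} (hI : I.card = 3)
    (hc : ∀ i ∈ I, a i ≤ c i ∧ c i ≤ a i + 1) (h1 : ∑ i ∈ I, a i < ∑ i ∈ I, c i)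
    (h2 : ∑ i ∈ I, c i < ∑ i ∈ I, a i + 3) : ∃ d u w, u < w ∧ d ≠ u ∧ d ≠ w ∧ I = {d, u, w} ∧
      ((c d = a d + 1 ∧ c u = a u ∧ c w = a w) ∨
        (c d = a d ∧ c u = a u + 1 ∧ c w = a w + 1)) := by
  suffices h : ∃ d u w, u ≠ w ∧ d ≠ u ∧ d ≠ w ∧ I = {d, u, w} ∧
      ((c d = a d + 1 ∧ c u = a u ∧ c w = a w) ∨
        (c d = a d ∧ c u = a u + 1 ∧ c w = a w + 1)) by
    obtain ⟨d, u, w, huw, hdu, hdw, hI, h⟩ := h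
    rcases lt_or_gt_of_ne huw with hlt | hlt
    · exact ⟨d, u, w, hlt, hdu, hdw, hI, h⟩
    · exact ⟨d, w, u, hlt, hdw, hdu, by rw [hI, Finset.pair_comm], by tauto⟩
  obtain ⟨x, y, z, hxy, hxz, hyz, rfl⟩ := Finset.card_eq_three.1 hI
  have hsum : ∀ f : Fin n → ℕ, ∑ i ∈ ({x, y, z} : Finset (Fin n)), f i = f x + (f y + f z) :=
    fun f => by
      rw [Finset.sum_insert (by simp [hxy, hxz]), Finset.sum_pair hyz]
  rw [hsum, hsum] at h1 h2
  have hx := hc x (by simp)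
  have hy := hc y (by simp)
  have hz := hc z (by simp)
  have e1 : ({x, y, z} : Finset (Fin n)) = {y, x, z} := by ext; simp; tauto
  have e2 : ({x, y, z} : Finset (Fin n)) = {z, x, y} := by ext; simp; tauto
  by_cases hxy' : c x - a x = c y - a y
  · exact ⟨z, x, y, hxy, hxz.symm, hyz.symm, e2, by omega⟩
  · by_cases hxz' : c x - a x = c z - a z
    · exact ⟨y, x, z, hxz, hxy.symm, hyz, e1, by omega⟩
    · exact ⟨x, y, z, hyz, hxy, hxz, rfl, by omega⟩

/-- Either coordinate of an edge may serve to compute the sign: one is at its upper bound exactly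
when the other is at its lower bound. -/
theorem incidence_vertex_edge (hk : 0 < k) {G : Face n k 1} {F : Face n k 2}
    (h : G.1 ⊆ closure F.1) {i j : Fin n} (hij : i ≠ j) (hm : moving F = {i, j}) :
    incidence G F = (if i < j then 1 else -1) * if corner G i = corner F i then 1 else -1 := by
  obtain ⟨-, hc⟩ := (subset_closure_iff hk).1 h
  have hi : i ∈ moving F := by simp [hm]
  have hj : j ∈ moving F := by simp [hm]
  rcases lt_or_gt_of_ne hij with hlt | hlt
  · rw [incidence_vertex hk h hi (by simp [hm, hlt.le]), if_pos hlt, one_mul]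
  · rw [incidence_vertex hk h hj (by simp [hm, hlt.le]), if_neg hlt.not_gt]
    have h1 := sum_add_sum_of_eq_off (I := moving F) fun l => (hc l).2.2
    have h2 := (hc i).2.1 hi
    have h3 := (hc j).2.1 hj
    have h4 := sum_corner_lt hk F
    rw [hm, Finset.sum_pair hij, Finset.sum_pair hij, sum_corner_vertex hk] at h1
    split_ifs <;> first | rfl | omega

/-- Two-dimensional cells are triangles. With d the odd coordinate at the vertex `H`, the two edges
through `H` are those in which u or w stops moving. -/
theorem sum_inc_mul_inc_vertex (hk : 0 < k) (H : Face n k 1) (F : Face n k 3) :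
    ∑ G : Face n k 2, inc H G * inc G F = 0 := by
  by_cases h : H.1 ⊆ closure F.1
  swap
  · exact sum_inc_mul_inc_of_not_subset h
  obtain ⟨-, hc⟩ := (subset_closure_iff hk).1 h
  have hsF := sum_corner_lt hk F
  have hsH := sum_corner_vertex hk H
  have hs := sum_add_sum_of_eq_off (I := moving F) fun l => (hc l).2.2
  obtain ⟨d, u, w, huw, hdu, hdw, hm, hv⟩ := exists_split_of_triangle (card_moving hk F)
    (fun i => (hc i).2.1) (by omega) (by omega)
  have hcorner : ∀ x y : Fin n, x ≠ y →
      ∑ i, (if i ∈ ({x, y} : Finset (Fin n)) then corner F i else corner H i) +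
        (corner H x + corner H y) = k + (corner F x + corner F y) := fun x y hxy => by
    have := sum_add_sum_of_eq_off (a := corner H)
      (c := fun i => if i ∈ ({x, y} : Finset (Fin n)) then corner F i else corner H i)
      (I := {x, y}) fun i hi => if_neg hi
    rw [Finset.sum_pair hxy, Finset.sum_pair hxy, hsH] at this
    simpa using this
  have hcell : ∀ x ∈ ({u, w} : Finset (Fin n)),
      IsCell k (fun i => if i ∈ ({d, x} : Finset (Fin n)) then corner F i else corner H i)
        {d, x} := fun x hx => by
    have hx : x = u ∨ x = w := by simpa using hx
    have hdx : d ≠ x := by rcases hx with rfl | rfl <;> assumption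
    have := hcorner d x hdx
    right
    rw [Finset.card_pair hdx]
    beta_reduce
    rcases hx with rfl | rfl <;> omega
  have hrank : ∀ x, d ≠ x → cellRank ({d, x} : Finset (Fin n)) = 2 := fun x hx => by
    rw [cellRank, if_neg (by simp), Finset.card_pair hx]
  let Gu : Face n k 2 := ofCell hk (hcell w (by simp)) (hrank w hdw)
  let Gw : Face n k 2 := ofCell hk (hcell u (by simp)) (hrank u hdu)
  have mu : moving Gu = {d, w} := moving_ofCell _ _ _
  have mw : moving Gw = {d, u} := moving_ofCell _ _ _
  have mu' : moving Gu = (moving F).erase u := by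
    rw [mu, hm]
    ext l
    simp only [Finset.mem_insert, Finset.mem_singleton, Finset.mem_erase]
    constructor
    · rintro (rfl | rfl)
      · exact ⟨hdu, by simp⟩
      · exact ⟨huw.ne', by simp⟩
    · tauto
  have mw' : moving Gw = (moving F).erase w := by
    rw [mw, hm]
    ext l
    simp only [Finset.mem_insert, Finset.mem_singleton, Finset.mem_erase]
    constructor
    · rintro (rfl | rfl)
      · exact ⟨hdw, by simp⟩
      · exact ⟨huw.ne, by simp⟩
    · tauto
  have hu : u ∈ moving F := by simp [hm]
  have hw : w ∈ moving F := by simp [hm]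
  obtain ⟨hu1, hu2⟩ := between_of_corner_eq hk (G := Gu) h (by simp [moving_vertex hk])
    (mu' ▸ Finset.erase_subset _ _) (fun l => by
    rw [mu]; exact congrFun (corner_ofCell _ _ _) l)
  obtain ⟨hw1, hw2⟩ := between_of_corner_eq hk (G := Gw) h (by simp [moving_vertex hk])
    (mw' ▸ Finset.erase_subset _ _) (fun l => by
    rw [mw]; exact congrFun (corner_ofCell _ _ _) l)
  refine sum_inc_mul_inc_of_two hk hu1 hu2 hw1 hw2 ?_ ?_ ?_
  · intro he
    rw [mu', mw'] at he
    have : w ∈ (moving F).erase w := he ▸ Finset.mem_erase.2 ⟨huw.ne', hw⟩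
    simp at this
  · intro G hHG hGF
    obtain ⟨l, hl, hGl⟩ := exists_moving_eq_erase hk hGF
    rw [hm] at hl
    simp only [Finset.mem_insert, Finset.mem_singleton] at hl
    rcases hl with rfl | rfl | rfl
    -- If d stopped moving, u and w would both be at their lower or both at their upper bounds at
    -- `H`; the corner of the edge would have degree k or k - 2 instead of k - 1.
    · exfalso
      have hG : moving G = {u, w} := by
        rw [hGl, hm, Finset.erase_insert (by simp [hdu, hdw])]
      have h1 := hcorner u w huw.ne
      have h2 := sum_corner_lt hk G
      simp only [corner_eq_of_between hk hHG hGF, hG] at h2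
      omega
    · exact Or.inl (hGl.trans mu'.symm)
    · exact Or.inr (hGl.trans mw'.symm)
  · have cu : corner Gu d = corner F d := by
      rw [corner_eq_of_between hk hu1 hu2, if_pos (by simp [mu])]
    have cw : corner Gw d = corner F d := by
      rw [corner_eq_of_between hk hw1 hw2, if_pos (by simp [mw])]
    have cu' : corner Gu u = corner H u := by
      rw [corner_eq_of_between hk hu1 hu2, if_neg (by simp [mu'])]
    have cw' : corner Gw w = corner H w := by
      rw [corner_eq_of_between hk hw1 hw2, if_neg (by simp [mw'])]
    have hd : d ∈ moving F := by simp [hm]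
    have pu : posSign (moving F) u = if d < u then -1 else 1 := by
      rw [posSign_erase hd, posSign_erase (i := w) (by simp [hdw.symm, hw]),
        if_neg huw.not_gt, posSign_eq_one_of_min, one_mul, one_mul]
      simp only [hm, Finset.mem_erase, Finset.mem_insert, Finset.mem_singleton]
      rintro i ⟨h1, h2, h3⟩
      have : i = u := by tauto
      exact this.ge
    have pw : posSign (moving F) w = if d < w then 1 else -1 := by
      rw [posSign_erase hd, posSign_erase (i := u) (by simp [hdu.symm, hu]),
        if_pos huw, posSign_eq_one_of_min]
      · split_ifs <;> norm_num
      simp only [hm, Finset.mem_erase, Finset.mem_insert, Finset.mem_singleton]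
      rintro i ⟨h1, h2, h3⟩
      have : i = w := by tauto
      exact this.ge
    rw [inc_of_subset hu1, inc_of_subset hu2, inc_of_subset hw1, inc_of_subset hw2,
      incidence_vertex_edge hk hu1 hdw mu, incidence_vertex_edge hk hw1 hdu mw,
      incidence_of_erase hk hu2 hu mu', incidence_of_erase hk hw2 hw mw', cu, cw, cu', cw',
      pu, pw]
    rcases hv with ⟨h1, h2, h3⟩ | ⟨h1, h2, h3⟩
    · simp only [h1, h2, h3]
      split_ifs <;> omega
    · simp only [h1, h2, h3]
      split_ifs <;> omega

theorem sum_inc_mul_inc (hk : 0 < k) (H : Face n k p) (F : Face n k (p + 2)) :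
    ∑ G : Face n k (p + 1), inc H G * inc G F = 0 := by
  rcases p with _ | _ | p
  · exact sum_inc_mul_inc_empty hk H F
  · exact sum_inc_mul_inc_vertex hk H F
  · exact sum_inc_mul_inc_high hk H F

end SubdividedSimplex

namespace SubdividedSimplex
/-! ## Cancelling matched cells -/

section Matching

open Matrix

variable {K : Type*} [Field K] {A B C : Type*} [Fintype A] [Fintype B]

/-- Gaussian elimination for a triangular system: the boundary of the partner of `G` meets other
sources only at smaller height, so sources are cleared from the greatest height downwards. -/
theorem exists_sub_mulVec_eq_zero (d : Matrix B A K) (SA : A → Prop) (S : B → Prop) (h : B → ℕ)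
    (hS : ∀ G, S G → ∃ F, SA F ∧ d G F ≠ 0 ∧
      ∀ G', S G' → G' ≠ G → d G' F ≠ 0 → h G' < h G) (z : B → K) :
    ∃ w : A → K, (∀ F, w F ≠ 0 → SA F) ∧ ∀ G, S G → (z - d *ᵥ w) G = 0 := by
  classical
  have hS' : ∀ G, S G → ∃ w : A → K, (∀ F, w F ≠ 0 → SA F) ∧ (d *ᵥ w) G = 1 ∧
      ∀ G', S G' → G' ≠ G → (d *ᵥ w) G' ≠ 0 → h G' < h G := by
    intro G hG
    obtain ⟨F, hF, hne, hlt⟩ := hS G hG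
    refine ⟨Pi.single F (d G F)⁻¹, fun F' hF' => ?_, ?_, fun G' hG' hG'' h0 => ?_⟩
    · by_cases h : F' = F
      · rwa [h]
      · simp [h] at hF'
    · simp [hne]
    · refine hlt G' hG' hG'' fun h => h0 ?_
      simp [h]
  choose! w hw1 hw2 hw3 using hS'
  suffices key : ∀ N : ℕ, ∀ z : B → K, (∀ G, S G → z G ≠ 0 → h G < N) →
      ∃ w : A → K, (∀ F, w F ≠ 0 → SA F) ∧ ∀ G, S G → (z - d *ᵥ w) G = 0 by
    refine key (Finset.univ.sup h + 1) z fun G _ _ => ?_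
    exact Nat.lt_succ_of_le (Finset.le_sup (Finset.mem_univ G))
  intro N
  induction N with
  | zero =>
    intro z hz
    refine ⟨0, by simp, fun G hG => ?_⟩
    rw [mulVec_zero, sub_zero]
    by_contra h0
    exact absurd (hz G hG h0) (Nat.not_lt_zero _)
  | succ N ih =>
    intro z hz
    -- All sources of height N are cleared together; since heights drop strictly, their corrections
    -- do not disturb one another.
    set w0 : A → K := ∑ G ∈ Finset.univ.filter (fun G => S G ∧ h G = N), z G • w G with hw0
    have hw0S : ∀ F, w0 F ≠ 0 → SA F := by
      intro F hF
      rw [hw0, Finset.sum_apply] at hF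
      obtain ⟨G, hG, hG'⟩ := Finset.exists_ne_zero_of_sum_ne_zero hF
      simp only [Finset.mem_filter, Finset.mem_univ, true_and] at hG
      exact hw1 G hG.1 F (right_ne_zero_of_mul hG')
    have hw0d : ∀ G', (d *ᵥ w0) G' =
        ∑ G ∈ Finset.univ.filter (fun G => S G ∧ h G = N), z G * (d *ᵥ w G) G' := by
      intro G'
      rw [hw0, mulVec_sum, Finset.sum_apply]
      simp only [mulVec_smul, Pi.smul_apply, smul_eq_mul]
    obtain ⟨w1, h1, h2⟩ := ih (z - d *ᵥ w0) (by
      intro G' hG' hne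
      by_contra hN
      rw [not_lt] at hN
      apply hne
      rw [Pi.sub_apply, hw0d]
      have hzero : ∀ G ∈ Finset.univ.filter (fun G => S G ∧ h G = N), G ≠ G' →
          z G * (d *ᵥ w G) G' = 0 := by
        intro G hG hGG'
        simp only [Finset.mem_filter, Finset.mem_univ, true_and] at hG
        by_contra h0
        have := hw3 G hG.1 G' hG' hGG'.symm (right_ne_zero_of_mul h0)
        omega
      rcases hN.eq_or_lt with hN | hN
      · rw [Finset.sum_eq_single G' hzero (by simp [hG', hN]), hw2 G' hG', mul_one, sub_self]
      · rw [Finset.sum_eq_zero fun G hG => hzero G hG (by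
          rintro rfl
          simp only [Finset.mem_filter, Finset.mem_univ, true_and] at hG
          omega), sub_zero]
        by_contra h0
        have := hz G' hG' h0
        omega)
    refine ⟨w0 + w1, fun F hF => ?_, fun G hG => ?_⟩
    · by_cases h0 : w0 F = 0
      · exact h1 F fun h => hF (by rw [Pi.add_apply, h0, h, add_zero])
      · exact hw0S F h0
    · rw [mulVec_add, ← sub_sub]
      exact h2 G hG

/-- Among the targets in the support of z take one of greatest height. At its downward partner `H`
no other cell of the support contributes, so d z is nonzero there. -/
theorem eq_zero_of_mulVec_eq_zero (d : Matrix C B K) (S T SB : B → Prop) (h : B → ℕ)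
    (hT : ∀ G, T G → ∃ H, d H G ≠ 0 ∧
      ∀ G', SB G' → ¬ S G' → G' ≠ G → d H G' ≠ 0 → T G' ∧ h G < h G')
    {z : B → K} (hz : ∀ G, z G ≠ 0 → SB G) (hzS : ∀ G, S G → z G = 0) (hd : d *ᵥ z = 0)
    {G : B} (hG : T G) : z G = 0 := by
  classical
  by_contra hne
  obtain ⟨G, hG, hmax⟩ := Finset.exists_max_image
    (Finset.univ.filter fun G => T G ∧ z G ≠ 0) h ⟨G, by simp [hG, hne]⟩
  simp only [Finset.mem_filter, Finset.mem_univ, true_and] at hG hmax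
  obtain ⟨H, hH, hlt⟩ := hT G hG.1
  have := congrFun hd H
  rw [mulVec, dotProduct, Finset.sum_eq_single G] at this
  · exact mul_ne_zero hH hG.2 this
  · intro G' _ hG'
    by_contra h0
    have hz' := right_ne_zero_of_mul h0
    obtain ⟨h1, h2⟩ := hlt G' (hz G' hz') (fun h => hz' (hzS G' h)) hG'
      (left_ne_zero_of_mul h0)
    exact absurd (hmax G' ⟨h1, hz'⟩) h2.not_ge
  · simp

/-- Suppose that the cells in `SB` outside `TB` are sources (matched with a cell of the next higher
dimension) or targets (matched with one of the next lower dimension), and that the matching is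
acyclic. Then every cycle on `SB` is homologous to a cycle on `TB`. -/
theorem exists_sub_mulVec_support (d₂ : Matrix B A K) (d₁ : Matrix C B K) (hdd : d₁ * d₂ = 0)
    (SA : A → Prop) (SB TB S T : B → Prop) (h : B → ℕ)
    (hSA : ∀ F G, SA F → d₂ G F ≠ 0 → SB G) (hcover : ∀ G, SB G → TB G ∨ S G ∨ T G)
    (hS : ∀ G, S G → ∃ F, SA F ∧ d₂ G F ≠ 0 ∧
      ∀ G', S G' → G' ≠ G → d₂ G' F ≠ 0 → h G' < h G)
    (hT : ∀ G, T G → ∃ H, d₁ H G ≠ 0 ∧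
      ∀ G', SB G' → ¬ S G' → G' ≠ G → d₁ H G' ≠ 0 → T G' ∧ h G < h G')
    {z : B → K} (hz : ∀ G, z G ≠ 0 → SB G) (hd : d₁ *ᵥ z = 0) :
    ∃ w : A → K, (∀ F, w F ≠ 0 → SA F) ∧ ∀ G, (z - d₂ *ᵥ w) G ≠ 0 → TB G := by
  obtain ⟨w, hw, hw0⟩ := exists_sub_mulVec_eq_zero d₂ SA S h hS z
  have hz' : ∀ G, (z - d₂ *ᵥ w) G ≠ 0 → SB G := by
    intro G hG
    by_contra hSB
    apply hG
    have h1 : z G = 0 := by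
      by_contra h0
      exact hSB (hz G h0)
    rw [Pi.sub_apply, h1, zero_sub, neg_eq_zero, mulVec, dotProduct]
    refine Finset.sum_eq_zero fun F _ => ?_
    -- The correction stays within `SB` because the boundary of a cell in `SA` does.
    by_contra h0
    exact hSB (hSA F G (hw F (right_ne_zero_of_mul h0)) (left_ne_zero_of_mul h0))
  refine ⟨w, hw, fun G hG => ?_⟩
  rcases hcover G (hz' G hG) with h | h | h
  · exact h
  · exact absurd (hw0 G h) hG
  · refine absurd (eq_zero_of_mulVec_eq_zero d₁ S T SB _ hT hz' hw0 ?_ h) hG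
    rw [mulVec_sub, hd, mulVec_mulVec, hdd, zero_mulVec, sub_zero]

end Matching

/-! ## Acyclicity -/

variable {n k p : ℕ}

open Matrix

/-- The boundary matrix of the complex with coefficients in a field. -/
noncomputable def incMatrix (K : Type*) [Field K] (n k p : ℕ) :
    Matrix (Face n k p) (Face n k (p + 1)) K :=
  fun G F => (inc G F : K)

theorem incMatrix_mul (K : Type*) [Field K] (hk : 0 < k) :
    incMatrix K n k p * incMatrix K n k (p + 1) = 0 := by
  ext H F
  rw [Matrix.mul_apply]
  simp only [incMatrix]
  exact_mod_cast congrArg (Int.cast : ℤ → K) (sum_inc_mul_inc hk H F)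

theorem sum_label (hk : 0 < k) (F : Face n k (p + 1)) :
    ∑ i, label F i = ∑ i, corner F i + (moving F).card := by
  simp only [label_apply hk, Finset.sum_add_distrib]
  simp

/-- Cells of the same rank all of whose labels divide a monomial of degree `k`. -/
theorem eq_of_label_le (hk : 0 < k) {c : Fin n →₀ ℕ} (hc : ∑ i, c i = k)
    {F : Face n k (p + 1)} (hF : label F ≤ c) : moving F = ∅ ∧ corner F = c := by
  have h1 : ∑ i, label F i ≤ ∑ i, c i := Finset.sum_le_sum fun i _ => hF i
  have h2 := sum_label hk F
  rcases F.isCell hk with ⟨hm, hs⟩ | h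
  · refine ⟨hm, funext fun i => ?_⟩
    have h3 : ∀ i, corner F i ≤ c i := fun i => by
      have := hF i
      rw [label_apply hk] at this
      omega
    exact (Finset.sum_eq_sum_iff_of_le fun i _ => h3 i).1 (hs.trans hc.symm) i
      (Finset.mem_univ i)
  · omega

/-- Only the vertex c can carry z, and its boundary is the empty face with coefficient 1. -/
theorem eq_zero_of_sum_eq {K : Type*} [Field K] (hk : 0 < k) {c : Fin n →₀ ℕ}
    (hc : ∑ i, c i = k) {z : Face n k (p + 1) → K} (hz : ∀ G, z G ≠ 0 → label G ≤ c)
    (hd : incMatrix K n k p *ᵥ z = 0) : z = 0 := by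
  funext G
  by_contra hG
  obtain ⟨hm, hcG⟩ := eq_of_label_le hk hc (hz G hG)
  have hp : p = 0 := by
    have := (G.spec hk).2.2
    rw [hm, cellRank, if_pos rfl] at this
    omega
  subst hp
  have h0 := congrFun hd (emptyFace n k)
  rw [mulVec, dotProduct, Finset.sum_eq_single G] at h0
  · refine mul_ne_zero (inc_cast_ne_zero_iff.2 ?_) hG h0
    exact Set.empty_subset _
  · intro G' _ hne
    by_contra h1
    obtain ⟨hm', hcG'⟩ := eq_of_label_le hk hc (hz G' (right_ne_zero_of_mul h1))
    exact hne (Face.ext_corner hk (hcG'.trans hcG.symm) (hm'.trans hm.symm))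
  · simp

end SubdividedSimplex

/-! ### The matching on cells whose label attains the exponent `c m`, and upward partners -/

namespace SubdividedSimplex
open Matrix

variable {n k p : ℕ}

/-- The cells that are matched with a cell of the next higher dimension. Here `c` bounds the
labels, `m` is the variable whose exponent is to be lowered, and `ι` selects a coordinate to move
for each lower corner. -/
def IsSource (c : Fin n →₀ ℕ) (m : Fin n) (ι : (Fin n → ℕ) → Fin n) (G : Face n k p) : Prop :=
  label G ≤ c ∧ label G m = c m ∧ ((m ∉ moving G ∧ (moving G).Nonempty) ∨
    ((moving G = ∅ ∨ (m ∈ moving G ∧ ∑ i, corner G i + 1 = k)) ∧ ι (corner G) ∉ moving G))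

/-- The cells that are matched with a cell of the next lower dimension. -/
def IsTarget (c : Fin n →₀ ℕ) (m : Fin n) (ι : (Fin n → ℕ) → Fin n) (G : Face n k p) : Prop :=
  label G ≤ c ∧ label G m = c m ∧ m ∈ moving G ∧
    (∑ i, corner G i + 1 < k ∨ (∑ i, corner G i + 1 = k ∧ ι (corner G) ∈ moving G))

open Classical in
/-- The order in which matched pairs are cancelled. -/
noncomputable def matchHeight (m : Fin n) (G : Face n k p) : ℕ :=
  if m ∈ moving G ∧ ∑ i, corner G i + 1 = k then 0 else 1

/-- Sources are the vertices, the other cells not moving in direction m, and the cells of corner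
degree k - 1 that move m but not ι; targets are the remaining cells moving m. -/
theorem isSource_or_isTarget (hk : 0 < k) {c : Fin n →₀ ℕ} {m : Fin n}
    (ι : (Fin n → ℕ) → Fin n) {G : Face n k (p + 1)} (hG : label G ≤ c)
    (hm : label G m = c m) : IsSource c m ι G ∨ IsTarget c m ι G := by
  rcases (moving G).eq_empty_or_nonempty with he | hne
  · exact Or.inl ⟨hG, hm, Or.inr ⟨Or.inl he, by simp [he]⟩⟩
  by_cases hmG : m ∈ moving G
  · have hs : ∑ i, corner G i < k := by
      rcases G.isCell hk with h | h
      · exact absurd h.1 hne.ne_empty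
      · exact h.1
    rcases (Nat.succ_le_of_lt hs).eq_or_lt with h | h
    · by_cases hι : ι (corner G) ∈ moving G
      · exact Or.inr ⟨hG, hm, hmG, Or.inr ⟨h, hι⟩⟩
      · exact Or.inl ⟨hG, hm, Or.inr ⟨Or.inr ⟨hmG, h⟩, hι⟩⟩
    · exact Or.inr ⟨hG, hm, hmG, Or.inl h⟩
  · exact Or.inl ⟨hG, hm, Or.inl ⟨hmG, hne⟩⟩

theorem sum_add_apply_of_eq_off {a a' : Fin n → ℕ} {m : Fin n} (h : ∀ i, i ≠ m → a' i = a i) :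
    ∑ i, a' i + a m = ∑ i, a i + a' m := by
  have := sum_add_sum_of_eq_off (a := a) (c := a') (I := {m}) fun i hi => h i (by simpa using hi)
  simpa using this

/-- The hypothesis compares the sums of `a` and `c` over the coordinates other than m, written
without subtraction. -/
theorem exists_ne_lt {a : Fin n → ℕ} {c : Fin n →₀ ℕ} {m : Fin n}
    (h : ∑ i, a i + c m < ∑ i, c i + a m) : ∃ i, i ≠ m ∧ a i < c i := by
  by_contra! hle
  have h1 := sum_add_apply_of_eq_off (a := c) (a' := fun i => if i = m then c m + a m else a i)
    (m := m)
  have h2 : ∑ i, c i + a m = ∑ i, (c i + if i = m then a m else 0) := by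
    rw [Finset.sum_add_distrib]; simp
  have h3 : ∑ i, a i + c m = ∑ i, (a i + if i = m then c m else 0) := by
    rw [Finset.sum_add_distrib]; simp
  rw [h2, h3] at h
  refine absurd h (not_lt.2 (Finset.sum_le_sum fun i _ => ?_))
  split_ifs with hi
  · rw [hi, add_comm]
  · simpa using hle i hi

theorem eq_of_le_of_sum_le {a b : Fin n → ℕ} (h : ∀ i, a i ≤ b i) (hs : ∑ i, b i ≤ ∑ i, a i) :
    a = b :=
  funext fun i => (Finset.sum_eq_sum_iff_of_le fun i _ => h i).1
    (le_antisymm (Finset.sum_le_sum fun i _ => h i) hs) i (Finset.mem_univ i)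

theorem corner_le_of_subset (hk : 0 < k) {q : ℕ} {G : Face n k (q + 1)} {F : Face n k (p + 1)}
    (h : G.1 ⊆ closure F.1) (i : Fin n) : corner F i ≤ corner G i := by
  obtain ⟨-, hc⟩ := (subset_closure_iff hk).1 h
  by_cases hi : i ∈ moving F
  · exact ((hc i).2.1 hi).1
  · exact ((hc i).2.2 hi).ge

theorem cellRank_eq {I : Finset (Fin n)} (h : I.card = p + 1) : cellRank I = p + 1 := by
  rw [cellRank, if_neg, h]
  rw [← Finset.card_eq_zero, h]
  omega

/-- The upward partner of a cell that does not move in direction `m`. -/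
theorem exists_up_of_notMem (hk : 0 < k) {c : Fin n →₀ ℕ} {m : Fin n} (hm : 0 < c m)
    (ι : (Fin n → ℕ) → Fin n) {G : Face n k (p + 2)} (hG : label G ≤ c) (hGm : label G m = c m)
    (hmG : m ∉ moving G) :
    ∃ F : Face n k (p + 3), label F ≤ c ∧ G.1 ⊆ closure F.1 ∧
      ∀ G' : Face n k (p + 2), IsSource c m ι G' → G' ≠ G → G'.1 ⊆ closure F.1 →
        matchHeight m G' < matchHeight m G := by
  have hcm : corner G m = c m := by
    rw [label_apply hk, if_neg hmG] at hGm
    exact hGm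
  have hs := sum_corner_lt hk G
  have hcard := card_moving hk G
  -- Lowering the corner at m and letting m move makes `G` the upper m-facet of `F`.
  set a : Fin n → ℕ := fun i => if i = m then corner G m - 1 else corner G i with ha
  have ham : a m = corner G m - 1 := if_pos rfl
  have hai : ∀ i, i ≠ m → a i = corner G i := fun i hi => if_neg hi
  have hsa := sum_add_apply_of_eq_off hai
  have hcI : (insert m (moving G)).card = p + 3 := by
    rw [Finset.card_insert_of_notMem hmG, hcard]
  have hcell : IsCell k a (insert m (moving G)) := by
    right
    rw [hcI]
    omega
  set F : Face n k (p + 3) := ofCell hk hcell (cellRank_eq hcI) with hF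
  have hFc : corner F = a := corner_ofCell _ _ _
  have hFm : moving F = insert m (moving G) := moving_ofCell _ _ _
  refine ⟨F, ?_, ?_, ?_⟩
  · intro i
    have hi := hG i
    rw [label_apply hk] at hi ⊢
    rw [hFc, hFm]
    by_cases him : i = m
    · subst him
      rw [ham, if_pos (by simp)]
      omega
    · simpa [hai i him, him] using hi
  · rw [subset_closure_iff hk, hFc, hFm]
    refine ⟨Finset.subset_insert _ _, fun i => ?_⟩
    by_cases him : i = m
    · subst him
      rw [ham]
      refine ⟨fun h => absurd h hmG, fun _ => by omega, fun h => by simp at h⟩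
    · rw [hai i him]
      exact ⟨fun _ => rfl, fun _ => by omega, fun _ => rfl⟩
  · intro G' hG' hne hsub
    obtain ⟨x, hx, hx'⟩ := exists_moving_eq_erase hk hsub
    obtain ⟨-, hc⟩ := (subset_closure_iff hk).1 hsub
    -- The lower m-facet of `F` has exponent c m - 1 at m and is not a source. A source that moves m
    -- has height 0, whereas `G` has height 1.
    have hmG' : m ∈ moving G' := by
      by_contra hmG'
      have hxm : x = m := by
        by_contra hxm
        exact hmG' (by rw [hx', hFm]; simp [Ne.symm hxm])
      subst hxm
      have hmov : moving G' = moving G := by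
        rw [hx', hFm, Finset.erase_insert hmG]
      refine hne (Face.ext_corner hk (funext fun i => ?_) hmov)
      by_cases him : i = x
      · subst him
        have := hG'.2.1
        rw [label_apply hk, if_neg hmG'] at this
        rw [hcm]
        exact this
      · rw [← hai i him, ← hFc]
        by_cases hiF : i ∈ moving F
        · exact (hc i).1 (by rw [hx']; exact Finset.mem_erase.2 ⟨him, hiF⟩)
        · exact (hc i).2.2 hiF
    have hsum : ∑ i, corner G' i + 1 = k := by
      rcases hG'.2.2 with h | ⟨h | h, -⟩
      · exact absurd hmG' h.1
      · simp [h] at hmG'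
      · exact h.2
    rw [matchHeight, matchHeight, if_pos ⟨hmG', hsum⟩, if_neg fun h => hmG h.1]
    exact Nat.zero_lt_one

/-- The upward partner of a cell whose lower corner has degree one less than the vertices. -/
theorem exists_up_of_mem (hk : 0 < k) {c : Fin n →₀ ℕ} {m : Fin n} (hc : k < ∑ i, c i)
    {ι : (Fin n → ℕ) → Fin n}
    (hι : ∀ a, (∃ i, i ≠ m ∧ a i < c i) → ι a ≠ m ∧ a (ι a) < c (ι a))
    {G : Face n k (p + 2)} (hG : label G ≤ c) (hGm : label G m = c m)
    (hmG : m ∈ moving G) (hsum : ∑ i, corner G i + 1 = k) (hιG : ι (corner G) ∉ moving G) :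
    ∃ F : Face n k (p + 3), label F ≤ c ∧ G.1 ⊆ closure F.1 ∧
      ∀ G' : Face n k (p + 2), IsSource c m ι G' → G' ≠ G → ¬ G'.1 ⊆ closure F.1 := by
  have hcm : corner G m + 1 = c m := by
    rwa [label_apply hk, if_pos hmG] at hGm
  obtain ⟨hιm, hιc⟩ := hι (corner G) (exists_ne_lt (by omega))
  have hcard := card_moving hk G
  set i := ι (corner G) with hi
  have hcI : (insert i (moving G)).card = p + 3 := by
    rw [Finset.card_insert_of_notMem hιG, hcard]
  have hcell : IsCell k (corner G) (insert i (moving G)) := by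
    right
    rw [hcI]
    omega
  set F : Face n k (p + 3) := ofCell hk hcell (cellRank_eq hcI) with hF
  have hFc : corner F = corner G := corner_ofCell _ _ _
  have hFm : moving F = insert i (moving G) := moving_ofCell _ _ _
  refine ⟨F, ?_, ?_, ?_⟩
  · intro j
    have hj := hG j
    rw [label_apply hk] at hj ⊢
    rw [hFc, hFm]
    by_cases hji : j = i
    · subst hji
      rw [if_pos (by simp)]
      omega
    · simpa [hji] using hj
  · rw [subset_closure_iff hk, hFc, hFm]
    exact ⟨Finset.subset_insert _ _, fun j => ⟨fun _ => rfl, fun _ => by omega, fun _ => rfl⟩⟩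
  · intro G' hG' hne hsub
    obtain ⟨x, hx, hx'⟩ := exists_moving_eq_erase hk hsub
    -- A facet of `F` is positive-dimensional, so its corner has degree below k; as `F` already has
    -- corner degree k - 1, no coordinate of the corner can be raised.
    have hcor : corner G' = corner G := by
      rw [← hFc]
      refine (eq_of_le_of_sum_le (corner_le_of_subset hk hsub) ?_).symm
      rw [hFc]
      have := sum_corner_lt hk G'
      omega
    have hxi : x ≠ i := by
      rintro rfl
      refine hne (Face.ext_corner hk hcor ?_)
      rw [hx', hFm, Finset.erase_insert hιG]
    have hxm : x ≠ m := by
      rintro rfl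
      have := hG'.2.1
      rw [label_apply hk, hx', if_neg (by simp), hcor] at this
      omega
    have hmG' : m ∈ moving G' := by
      rw [hx', hFm]
      simp [hxm.symm, hmG]
    have hiG' : i ∈ moving G' := by
      rw [hx', hFm]
      simp [hxi.symm]
    rcases hG'.2.2 with h | ⟨-, h⟩
    · exact h.1 hmG'
    · rw [hcor] at h
      exact h hiG'

/-- The upward partner of a vertex. -/
theorem exists_up_vertex (hk : 0 < k) {c : Fin n →₀ ℕ} {m : Fin n} (hc : k < ∑ i, c i)
    (hm : 0 < c m) (ι : (Fin n → ℕ) → Fin n)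
    {G : Face n k 1} (hG : label G ≤ c) (hGm : label G m = c m) :
    ∃ F : Face n k 2, label F ≤ c ∧ G.1 ⊆ closure F.1 ∧
      ∀ G' : Face n k 1, IsSource c m ι G' → G' ≠ G → ¬ G'.1 ⊆ closure F.1 := by
  have hmov := moving_vertex hk G
  have hsum := sum_corner_vertex hk G
  have hcm : corner G m = c m := by
    rwa [label_apply hk, hmov, if_neg (by simp)] at hGm
  obtain ⟨i, him, hic⟩ := exists_ne_lt (a := corner G) (c := c) (m := m) (by omega)
  -- The edge runs from `G` to G - e_m + e_i, whose exponent at m is too small for a source.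
  set a : Fin n → ℕ := fun i => if i = m then corner G m - 1 else corner G i with ha
  have ham : a m = corner G m - 1 := if_pos rfl
  have hai : ∀ i, i ≠ m → a i = corner G i := fun i hi => if_neg hi
  have hsa := sum_add_apply_of_eq_off hai
  have hcI : ({m, i} : Finset (Fin n)).card = 2 := Finset.card_pair him.symm
  have hcell : IsCell k a {m, i} := by
    right
    rw [hcI]
    omega
  set F : Face n k 2 := ofCell hk hcell (cellRank_eq hcI) with hF
  have hFc : corner F = a := corner_ofCell _ _ _
  have hFm : moving F = {m, i} := moving_ofCell _ _ _
  refine ⟨F, ?_, ?_, ?_⟩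
  · intro j
    have hj := hG j
    rw [label_apply hk] at hj ⊢
    rw [hFc, hFm]
    by_cases hjm : j = m
    · subst hjm
      rw [ham, if_pos (by simp)]
      omega
    · rw [hai j hjm]
      by_cases hji : j = i
      · subst hji
        rw [if_pos (by simp)]
        omega
      · rw [if_neg (by simp [hjm, hji])]
        omega
  · rw [subset_closure_iff hk, hFc, hFm, hmov]
    refine ⟨by simp, fun j => ⟨by simp, fun hj => ?_, fun hj => ?_⟩⟩
    · by_cases hjm : j = m
      · subst hjm
        omega
      · rw [hai j hjm]
        omega
    · rw [hai j (by rintro rfl; simp at hj)]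
  · intro G' hG' hne hsub
    obtain ⟨-, hc'⟩ := (subset_closure_iff hk).1 hsub
    have hmov' := moving_vertex hk G'
    have hG'm := hG'.2.1
    rw [label_apply hk, hmov', if_neg (by simp)] at hG'm
    refine hne (Face.ext_corner hk (Eq.symm (eq_of_le_of_sum_le (fun j => ?_) ?_))
      (hmov'.trans hmov.symm))
    · by_cases hjm : j = m
      · subst hjm
        omega
      · rw [← hai j hjm, ← hFc]
        exact corner_le_of_subset hk hsub j
    · rw [sum_corner_vertex hk, hsum]

/-- This is the triangularity required of sources. Heights matter only for positive-dimensional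
cells that do not move m; in the other cases no other source is a facet of the partner. -/
theorem exists_up (hk : 0 < k) {c : Fin n →₀ ℕ} {m : Fin n} (hc : k < ∑ i, c i)
    (hm : 0 < c m) {ι : (Fin n → ℕ) → Fin n}
    (hι : ∀ a, (∃ i, i ≠ m ∧ a i < c i) → ι a ≠ m ∧ a (ι a) < c (ι a))
    {G : Face n k (p + 1)} (hG : IsSource c m ι G) :
    ∃ F : Face n k (p + 2), label F ≤ c ∧ G.1 ⊆ closure F.1 ∧
      ∀ G' : Face n k (p + 1), IsSource c m ι G' → G' ≠ G → G'.1 ⊆ closure F.1 →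
        matchHeight m G' < matchHeight m G := by
  obtain ⟨hG1, hG2, hG3⟩ := hG
  rcases p with _ | p
  · obtain ⟨F, h1, h2, h3⟩ := exists_up_vertex hk hc hm ι hG1 hG2
    exact ⟨F, h1, h2, fun G' h h' h'' => absurd h'' (h3 G' h h')⟩
  · by_cases hmG : m ∈ moving G
    · rcases hG3 with h | ⟨h | h, h'⟩
      · exact absurd hmG h.1
      · simp [h] at hmG
      · obtain ⟨F, h1, h2, h3⟩ := exists_up_of_mem hk hc hι hG1 hG2 hmG h.2 h'
        exact ⟨F, h1, h2, fun G' h h' h'' => absurd h'' (h3 G' h h')⟩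
    · exact exists_up_of_notMem hk hm ι hG1 hG2 hmG

end SubdividedSimplex

/-! ### Downward partners, and acyclicity of the cells with bounded label -/

namespace SubdividedSimplex
open Matrix

variable {n k p : ℕ}

/-- The downward partner of a cell that has an upper facet in direction `m`. -/
theorem exists_down_of_lt (hk : 0 < k) {c : Fin n →₀ ℕ} {m : Fin n} (ι : (Fin n → ℕ) → Fin n)
    {G : Face n k (p + 3)} (hGm : label G m = c m) (hmG : m ∈ moving G)
    (hsum : ∑ i, corner G i + 1 < k) :
    ∃ H : Face n k (p + 2), H.1 ⊆ closure G.1 ∧ ∀ G' : Face n k (p + 3), label G' ≤ c →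
      ¬ IsSource c m ι G' → G' ≠ G → ¬ H.1 ⊆ closure G'.1 := by
  have hcm : corner G m + 1 = c m := by
    rwa [label_apply hk, if_pos hmG] at hGm
  have hs := sum_corner_lt hk G
  -- The corner of the upper m-facet; `hsum` ensures that this facet is not degenerate.
  set a : Fin n → ℕ := fun i => if i = m then corner G m + 1 else corner G i with ha
  have ham : a m = corner G m + 1 := if_pos rfl
  have hai : ∀ i, i ≠ m → a i = corner G i := fun i hi => if_neg hi
  have hsa := sum_add_apply_of_eq_off hai
  have hcI : ((moving G).erase m).card = p + 2 := by
    rw [Finset.card_erase_of_mem hmG, card_moving hk]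
    omega
  have hcell : IsCell k a ((moving G).erase m) := by
    right
    rw [hcI]
    omega
  set H : Face n k (p + 2) := ofCell hk hcell (cellRank_eq hcI) with hH
  have hHc : corner H = a := corner_ofCell _ _ _
  have hHm : moving H = (moving G).erase m := moving_ofCell _ _ _
  refine ⟨H, ?_, ?_⟩
  · rw [subset_closure_iff hk, hHc, hHm]
    refine ⟨Finset.erase_subset _ _, fun i => ?_⟩
    by_cases him : i = m
    · subst him
      rw [ham]
      exact ⟨fun h => by simp at h, fun _ => by omega, fun h => absurd hmG h⟩
    · rw [hai i him]
      exact ⟨fun _ => rfl, fun _ => by omega, fun _ => rfl⟩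
  · intro G' hG' hnS hne hsub
    obtain ⟨x, hx, hx'⟩ := exists_moving_eq_erase hk hsub
    obtain ⟨-, hc⟩ := (subset_closure_iff hk).1 hsub
    have hle := label_le_of_subset hk hsub m
    rw [label_apply hk, hHc, hHm, if_neg (by simp), ham, hcm] at hle
    have hG'm : label G' m = c m := le_antisymm (hG' m) hle
    -- `H`, hence also `G'`, has exponent c m at m. If `G'` moves m, it has `H` as its upper m-facet
    -- and equals `G`; otherwise it is a source.
    by_cases hmG' : m ∈ moving G'
    · have hxm : x = m := by
        by_contra hxm
        have : m ∈ moving H := by rw [hx']; exact Finset.mem_erase.2 ⟨Ne.symm hxm, hmG'⟩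
        simp [hHm] at this
      subst hxm
      have hmov : moving G' = moving G := by
        rw [← Finset.insert_erase hx, ← hx', hHm, Finset.insert_erase hmG]
      refine hne (Face.ext_corner hk (funext fun i => ?_) hmov)
      by_cases him : i = x
      · subst him
        rw [label_apply hk, if_pos hmG'] at hG'm
        omega
      · rw [← hai i him, ← hHc]
        by_cases hiF : i ∈ moving G'
        · exact ((hc i).1 (by rw [hx']; exact Finset.mem_erase.2 ⟨him, hiF⟩)).symm
        · exact ((hc i).2.2 hiF).symm
    · exact hnS ⟨hG', hG'm, Or.inl ⟨hmG', ⟨x, hx⟩⟩⟩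

/-- The downward partner of a cell whose lower corner has degree one less than the vertices. -/
theorem exists_down_of_eq (hk : 0 < k) {c : Fin n →₀ ℕ} {m : Fin n} (hc : k < ∑ i, c i)
    {ι : (Fin n → ℕ) → Fin n}
    (hι : ∀ a, (∃ i, i ≠ m ∧ a i < c i) → ι a ≠ m ∧ a (ι a) < c (ι a))
    {G : Face n k (p + 3)} (hGm : label G m = c m) (hmG : m ∈ moving G)
    (hsum : ∑ i, corner G i + 1 = k) (hιG : ι (corner G) ∈ moving G) :
    ∃ H : Face n k (p + 2), H.1 ⊆ closure G.1 ∧ ∀ G' : Face n k (p + 3), label G' ≤ c →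
      ¬ IsSource c m ι G' → G' ≠ G → H.1 ⊆ closure G'.1 →
        IsTarget c m ι G' ∧ matchHeight m G < matchHeight m G' := by
  have hcm : corner G m + 1 = c m := by
    rwa [label_apply hk, if_pos hmG] at hGm
  obtain ⟨hιm, -⟩ := hι (corner G) (exists_ne_lt (by omega))
  set i := ι (corner G) with hi
  have hcI : ((moving G).erase i).card = p + 2 := by
    rw [Finset.card_erase_of_mem hιG, card_moving hk]
    omega
  have hcell : IsCell k (corner G) ((moving G).erase i) := by
    right
    rw [hcI]
    omega
  set H : Face n k (p + 2) := ofCell hk hcell (cellRank_eq hcI) with hH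
  have hHc : corner H = corner G := corner_ofCell _ _ _
  have hHm : moving H = (moving G).erase i := moving_ofCell _ _ _
  refine ⟨H, ?_, ?_⟩
  · rw [subset_closure_iff hk, hHc, hHm]
    exact ⟨Finset.erase_subset _ _, fun j => ⟨fun _ => rfl, fun _ => by omega, fun _ => rfl⟩⟩
  · intro G' hG' hnS hne hsub
    obtain ⟨x, hx, hx'⟩ := exists_moving_eq_erase hk hsub
    have hle := label_le_of_subset hk hsub m
    have hmH : m ∈ moving H := by
      rw [hHm]
      exact Finset.mem_erase.2 ⟨hιm.symm, hmG⟩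
    rw [label_apply hk, if_pos hmH, hHc, hcm] at hle
    have hG'm : label G' m = c m := le_antisymm (hG' m) hle
    have hmG' : m ∈ moving G' := by
      rw [hx'] at hmH
      exact Finset.mem_of_mem_erase hmH
    have hT := (isSource_or_isTarget hk ι hG' hG'm).resolve_left hnS
    refine ⟨hT, ?_⟩
    rw [matchHeight, matchHeight, if_pos ⟨hmG, hsum⟩, if_neg]
    · exact Nat.zero_lt_one
    -- If the corner of `G'` also had degree k - 1, it would equal that of `G`. Being a target, `G'`
    -- would then move the same ι, so `H` would be `G'` with ι erased and `G'` would be `G`.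
    · rintro ⟨-, hsum'⟩
      have hcor : corner G' = corner G := by
        rw [← hHc]
        refine eq_of_le_of_sum_le (corner_le_of_subset hk hsub) ?_
        rw [hHc]
        omega
      have hιG' : i ∈ moving G' := by
        rcases hT.2.2.2 with h | h
        · omega
        · rw [hcor] at h
          exact h.2
      have hxi : x = i := by
        by_contra hxi
        have : i ∈ moving H := by rw [hx']; exact Finset.mem_erase.2 ⟨Ne.symm hxi, hιG'⟩
        simp [hHm] at this
      subst hxi
      refine hne (Face.ext_corner hk hcor ?_)
      rw [← Finset.insert_erase hx, ← hx', hHm, Finset.insert_erase hιG]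

theorem moving_eq_pair (hk : 0 < k) {G : Face n k 2} {i j : Fin n} (hij : i ≠ j)
    (hi : i ∈ moving G) (hj : j ∈ moving G) : moving G = {i, j} := by
  symm
  apply Finset.eq_of_subset_of_card_le
  · intro l hl
    simp only [Finset.mem_insert, Finset.mem_singleton] at hl
    rcases hl with rfl | rfl <;> assumption
  · rw [card_moving hk, Finset.card_pair hij]

/-- The downward partner of an edge. -/
theorem exists_down_edge (hk : 0 < k) {c : Fin n →₀ ℕ} {m : Fin n} (hc : k < ∑ i, c i)
    {ι : (Fin n → ℕ) → Fin n}
    (hι : ∀ a, (∃ i, i ≠ m ∧ a i < c i) → ι a ≠ m ∧ a (ι a) < c (ι a))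
    {G : Face n k 2} (hGm : label G m = c m) (hmG : m ∈ moving G)
    (hιG : ι (corner G) ∈ moving G) :
    ∃ H : Face n k 1, H.1 ⊆ closure G.1 ∧ ∀ G' : Face n k 2, label G' ≤ c →
      ¬ IsSource c m ι G' → G' ≠ G → ¬ H.1 ⊆ closure G'.1 := by
  have hcm : corner G m + 1 = c m := by
    rwa [label_apply hk, if_pos hmG] at hGm
  have hs := sum_corner_lt hk G
  obtain ⟨hιm, -⟩ := hι (corner G) (exists_ne_lt (by omega))
  -- `H` is the end of the edge with the larger m-th coordinate. A non-source edge through it has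
  -- the same corner as `G`, so it moves m and the same ι, and is `G`.
  set a : Fin n → ℕ := fun i => if i = m then corner G m + 1 else corner G i with ha
  have ham : a m = corner G m + 1 := if_pos rfl
  have hai : ∀ i, i ≠ m → a i = corner G i := fun i hi => if_neg hi
  have hsa := sum_add_apply_of_eq_off hai
  have hcell : IsCell k a ∅ := Or.inl ⟨rfl, by omega⟩
  set H : Face n k 1 := ofCell hk hcell rfl with hH
  have hHc : corner H = a := corner_ofCell _ _ _
  have hHm : moving H = ∅ := moving_ofCell _ _ _
  refine ⟨H, ?_, ?_⟩
  · rw [subset_closure_iff hk, hHc, hHm]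
    refine ⟨Finset.empty_subset _, fun i => ?_⟩
    by_cases him : i = m
    · subst him
      rw [ham]
      exact ⟨fun h => by simp at h, fun _ => by omega, fun h => absurd hmG h⟩
    · rw [hai i him]
      exact ⟨fun _ => rfl, fun _ => by omega, fun _ => rfl⟩
  · intro G' hG' hnS hne hsub
    have hle := label_le_of_subset hk hsub m
    rw [label_apply hk, hHc, hHm, if_neg (by simp), ham, hcm] at hle
    have hG'm : label G' m = c m := le_antisymm (hG' m) hle
    have hT := (isSource_or_isTarget hk ι hG' hG'm).resolve_left hnS
    have hs' := sum_corner_lt hk G'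
    rw [label_apply hk, if_pos hT.2.2.1] at hG'm
    have hcor : corner G' = corner G := by
      refine eq_of_le_of_sum_le (fun j => ?_) (by omega)
      by_cases hjm : j = m
      · subst hjm
        omega
      · rw [← hai j hjm, ← hHc]
        exact corner_le_of_subset hk hsub j
    have hιG' : ι (corner G) ∈ moving G' := by
      rcases hT.2.2.2 with h | h
      · omega
      · rw [← hcor]
        exact h.2
    exact hne (Face.ext_corner hk hcor ((moving_eq_pair hk hιm hιG' hT.2.2.1).trans
      (moving_eq_pair hk hιm hιG hmG).symm))

/-- The triangularity required of targets. Edges always have corner degree k - 1, so for them only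
the second kind of target occurs. -/
theorem exists_down (hk : 0 < k) {c : Fin n →₀ ℕ} {m : Fin n} (hc : k < ∑ i, c i)
    {ι : (Fin n → ℕ) → Fin n}
    (hι : ∀ a, (∃ i, i ≠ m ∧ a i < c i) → ι a ≠ m ∧ a (ι a) < c (ι a))
    {G : Face n k (p + 1)} (hG : IsTarget c m ι G) :
    ∃ H : Face n k p, H.1 ⊆ closure G.1 ∧ ∀ G' : Face n k (p + 1), label G' ≤ c →
      ¬ IsSource c m ι G' → G' ≠ G → H.1 ⊆ closure G'.1 →
        IsTarget c m ι G' ∧ matchHeight m G < matchHeight m G' := by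
  obtain ⟨-, hGm, hmG, hG⟩ := hG
  rcases p with _ | _ | p
  · simp [moving_vertex hk] at hmG
  · have hιG : ι (corner G) ∈ moving G := by
      have := sum_corner_lt hk G
      rcases hG with h | h
      · omega
      · exact h.2
    obtain ⟨H, h1, h2⟩ := exists_down_edge hk hc hι hGm hmG hιG
    exact ⟨H, h1, fun G' h h' h'' h''' => absurd h''' (h2 G' h h' h'')⟩
  · rcases hG with h | h
    · obtain ⟨H, h1, h2⟩ := exists_down_of_lt hk ι hGm hmG h
      exact ⟨H, h1, fun G' h h' h'' h''' => absurd h''' (h2 G' h h' h'')⟩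
    · exact exists_down_of_eq hk hc hι hGm hmG h.1 h.2

theorem label_le_of_facet (hk : 0 < k) {G : Face n k p} {F : Face n k (p + 1)}
    (h : G.1 ⊆ closure F.1) : label G ≤ label F := by
  rcases p with _ | p
  · rw [label_of_empty]
    exact bot_le
  · exact label_le_of_subset hk h

/-- The subcomplex of the cells whose labels divide a monomial in `𝔪ᵏ` is acyclic. -/
theorem exists_mulVec_eq {K : Type*} [Field K] (hk : 0 < k) :
    ∀ (c : Fin n →₀ ℕ), k ≤ ∑ i, c i → ∀ z : Face n k (p + 1) → K,
      (∀ G, z G ≠ 0 → label G ≤ c) → incMatrix K n k p *ᵥ z = 0 →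
        ∃ w : Face n k (p + 2) → K, (∀ F, w F ≠ 0 → label F ≤ c) ∧
          incMatrix K n k (p + 1) *ᵥ w = z := by
  intro c
  induction hN : ∑ i, c i generalizing c with
  | zero =>
    intro h
    omega
  | succ N ih =>
    intro hkc z hz hd
    rcases hkc.eq_or_lt with h | h
    · refine ⟨0, by simp, ?_⟩
      rw [mulVec_zero, eq_zero_of_sum_eq hk (hN.trans h.symm) hz hd]
    obtain ⟨m, hm⟩ : ∃ m, 0 < c m := by
      by_contra! h0
      rw [Finset.sum_eq_zero fun i _ => Nat.le_zero.1 (h0 i)] at hN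
      omega
    -- The choice depends on the corner alone, so it does not change when ι itself is added to or
    -- removed from the moving set. The value m is a dummy for corners with no admissible
    -- coordinate.
    obtain ⟨ι, hι⟩ : ∃ ι : (Fin n → ℕ) → Fin n,
        ∀ a, (∃ i, i ≠ m ∧ a i < c i) → ι a ≠ m ∧ a (ι a) < c (ι a) := by
      have : ∀ a : Fin n → ℕ, ∃ i, (∃ i, i ≠ m ∧ a i < c i) → i ≠ m ∧ a i < c i := fun a => by
        by_cases h : ∃ i, i ≠ m ∧ a i < c i
        · obtain ⟨i, hi⟩ := h
          exact ⟨i, fun _ => hi⟩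
        · exact ⟨m, fun h' => absurd h' h⟩
      exact ⟨fun a => (this a).choose, fun a => (this a).choose_spec⟩
    have hc' : c = c - Finsupp.single m 1 + Finsupp.single m 1 := by
      rw [tsub_add_cancel_of_le]
      rw [Finsupp.single_le_iff]
      exact hm
    have hsum : ∑ i, (c - Finsupp.single m 1 : Fin n →₀ ℕ) i = N := by
      rw [hc'] at hN
      simp only [Finsupp.add_apply, Finset.sum_add_distrib, Finsupp.single_apply] at hN
      simpa using hN
    obtain ⟨w, hw, hzw⟩ := exists_sub_mulVec_support (incMatrix K n k (p + 1))
      (incMatrix K n k p) (incMatrix_mul K hk) (fun F => label F ≤ c) (fun G => label G ≤ c)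
      (fun G => label G ≤ c - Finsupp.single m 1) (IsSource c m ι) (IsTarget c m ι)
      (matchHeight m)
      (fun F G hF hne => (label_le_of_facet hk (inc_cast_ne_zero_iff.1 hne)).trans hF)
      (fun G hG => by
        by_cases hGm : label G m = c m
        · exact Or.inr (isSource_or_isTarget hk ι hG hGm)
        · refine Or.inl fun i => ?_
          have hi := hG i
          rw [Finsupp.tsub_apply, Finsupp.single_apply]
          split_ifs with him
          · subst him
            omega
          · simpa using hi)
      (fun G hG => by
        obtain ⟨F, h1, h2, h3⟩ := exists_up hk (by omega) hm hι hG
        exact ⟨F, h1, inc_cast_ne_zero_iff.2 h2, fun G' h h' h'' =>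
          h3 G' h h' (inc_cast_ne_zero_iff.1 h'')⟩)
      (fun G hG => by
        obtain ⟨H, h1, h2⟩ := exists_down hk (by omega) hι hG
        exact ⟨H, inc_cast_ne_zero_iff.2 h1, fun G' h h' h'' h''' =>
          h2 G' h h' h'' (inc_cast_ne_zero_iff.1 h''')⟩)
      hz hd
    obtain ⟨w', hw', hw'z⟩ := ih (c - Finsupp.single m 1) hsum (by omega) _ hzw (by
      rw [mulVec_sub, hd, mulVec_mulVec, incMatrix_mul K hk, zero_mulVec, sub_zero])
    refine ⟨w + w', fun F hF => ?_, ?_⟩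
    · by_cases h0 : w F = 0
      · exact (hw' F fun h => hF (by rw [Pi.add_apply, h0, h, add_zero])).trans tsub_le_self
      · exact hw F h0
    · rw [mulVec_add, hw'z, add_sub_cancel]

end SubdividedSimplex

namespace SubdividedSimplex
open Matrix

variable {n k p : ℕ}

/-! ## Exactness over the polynomial ring -/

section Resolution

variable {K : Type u} [Field K]

theorem boundary_apply (z : FreeMod K n k (p + 1)) (G : Face n k p) :
    boundary K n k p z G =
      ∑ F, z F * MvPolynomial.monomial (label F - label G) (inc G F : K) := by
  classical
  rw [boundary, Finsupp.linearCombination_apply, Finsupp.sum_fintype _ _ (by simp),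
    Finsupp.finsetSum_apply]
  refine Finset.sum_congr rfl fun F _ => ?_
  rw [Finsupp.smul_apply, Finsupp.finsetSum_apply, Finset.sum_eq_single G, smul_eq_mul, inc]
  · split_ifs with h <;> simp
  · intro G' _ hne
    split_ifs with h
    · rw [Finsupp.single_eq_of_ne hne.symm]
    · rfl
  · simp

open Classical in
/-- The homogeneous component of multidegree `c` of an element of a free module of the complex. -/
noncomputable def component (c : Fin n →₀ ℕ) : FreeMod K n k p →+ (Face n k p → K) where
  toFun z F := if label F ≤ c then MvPolynomial.coeff (c - label F) (z F) else 0
  map_zero' := by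
    ext F
    simp
  map_add' z z' := by
    ext F
    simp only [Finsupp.add_apply, MvPolynomial.coeff_add, Pi.add_apply]
    split_ifs <;> simp

theorem component_of_le {c : Fin n →₀ ℕ} {z : FreeMod K n k p} {F : Face n k p}
    (h : label F ≤ c) : component c z F = MvPolynomial.coeff (c - label F) (z F) :=
  if_pos h

theorem component_of_not_le {c : Fin n →₀ ℕ} {z : FreeMod K n k p} {F : Face n k p}
    (h : ¬ label F ≤ c) : component c z F = 0 :=
  if_neg h

theorem label_le_of_component_ne_zero {c : Fin n →₀ ℕ} {z : FreeMod K n k p} {F : Face n k p}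
    (h : component c z F ≠ 0) : label F ≤ c := by
  by_contra h'
  exact h (component_of_not_le h')

theorem ext_component {z z' : FreeMod K n k p}
    (h : ∀ c, component c z = component c z') : z = z' := by
  ext F u
  have := congrFun (h (u + label F)) F
  rwa [component_of_le le_add_self, component_of_le le_add_self, add_tsub_cancel_right] at this

/-- For incident cells the labels are comparable, so the truncated differences of exponents are true
differences and the monomials only account for the grading. -/
theorem component_boundary (hk : 0 < k) (c : Fin n →₀ ℕ) (z : FreeMod K n k (p + 1)) :
    component c (boundary K n k p z) = incMatrix K n k p *ᵥ component c z := by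
  ext G
  rw [mulVec, dotProduct]
  by_cases hG : label G ≤ c
  · rw [component_of_le hG, boundary_apply, MvPolynomial.coeff_sum]
    refine Finset.sum_congr rfl fun F _ => ?_
    rw [MvPolynomial.coeff_mul_monomial', incMatrix]
    by_cases h0 : (inc G F : K) = 0
    · simp [h0]
    · have hGF := label_le_of_facet hk (inc_cast_ne_zero_iff.1 h0)
      have hiff : label F - label G ≤ c - label G ↔ label F ≤ c := by
        rw [tsub_le_iff_right, tsub_add_cancel_of_le hG]
      by_cases hF : label F ≤ c
      · rw [if_pos (hiff.2 hF), component_of_le hF, tsub_tsub_tsub_cancel_right hGF, mul_comm]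
      · rw [if_neg fun h => hF (hiff.1 h), component_of_not_le hF, mul_zero]
  · rw [component_of_not_le hG, Finset.sum_eq_zero]
    intro F _
    by_contra h0
    have hF := label_le_of_component_ne_zero (right_ne_zero_of_mul h0)
    exact hG ((label_le_of_facet hk (inc_cast_ne_zero_iff.1 (left_ne_zero_of_mul h0))).trans hF)

/-- The homogeneous element of multidegree `c` with given coefficients. -/
noncomputable def homogeneous (c : Fin n →₀ ℕ) (w : Face n k p → K) : FreeMod K n k p :=
  Finsupp.equivFunOnFinite.symm fun F => MvPolynomial.monomial (c - label F) (w F)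

theorem component_homogeneous {c : Fin n →₀ ℕ} {w : Face n k p → K}
    (hw : ∀ F, w F ≠ 0 → label F ≤ c) (c' : Fin n →₀ ℕ) :
    component c' (homogeneous c w) = if c' = c then w else 0 := by
  classical
  ext F
  by_cases h0 : w F = 0
  · have : component c' (homogeneous c w) F = 0 := by
      by_cases hF : label F ≤ c'
      · rw [component_of_le hF]
        simp [homogeneous, h0]
      · exact component_of_not_le hF
    rw [this]
    split_ifs <;> simp [h0]
  · have hc := hw F h0
    by_cases hF : label F ≤ c'
    · rw [component_of_le hF]
      simp only [homogeneous, Finsupp.equivFunOnFinite_symm_apply_apply,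
        MvPolynomial.coeff_monomial, tsub_left_inj hc hF, eq_comm (a := c)]
      split_ifs <;> rfl
    · rw [component_of_not_le hF, if_neg]
      · rfl
      · rintro rfl
        exact hF hc

open Classical in
theorem eq_sum_homogeneous (z : FreeMod K n k p) :
    z = ∑ c ∈ Finset.univ.biUnion (fun F => (z F).support.image fun u => u + label F),
      homogeneous c (component c z) := by
  refine ext_component fun c => ?_
  rw [map_sum]
  simp only [component_homogeneous fun F hF => label_le_of_component_ne_zero hF]
  rw [Finset.sum_ite_eq]
  split_ifs with h
  · rfl
  · ext F
    by_contra h0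
    have hF := label_le_of_component_ne_zero h0
    rw [component_of_le hF] at h0
    refine h (Finset.mem_biUnion.2 ⟨F, Finset.mem_univ F, Finset.mem_image.2 ⟨c - label F, ?_,
      tsub_add_cancel_of_le hF⟩⟩)
    exact MvPolynomial.mem_support_iff.2 h0

theorem le_sum_label (hk : 0 < k) (F : Face n k (p + 1)) : k ≤ ∑ i, label F i := by
  rw [sum_label hk]
  rcases F.isCell hk with h | h
  · rw [h.2]
    exact Nat.le_add_right _ _
  · exact h.2.le

theorem boundary_homogeneous (hk : 0 < k) {c : Fin n →₀ ℕ} {w : Face n k (p + 1) → K}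
    (hw : ∀ F, w F ≠ 0 → label F ≤ c) :
    boundary K n k p (homogeneous c w) = homogeneous c (incMatrix K n k p *ᵥ w) := by
  have hw' : ∀ G, (incMatrix K n k p *ᵥ w) G ≠ 0 → label G ≤ c := by
    intro G hG
    obtain ⟨F, -, hF⟩ := Finset.exists_ne_zero_of_sum_ne_zero hG
    exact (label_le_of_facet hk (inc_cast_ne_zero_iff.1 (left_ne_zero_of_mul hF))).trans
      (hw F (right_ne_zero_of_mul hF))
  refine ext_component fun c' => ?_
  rw [component_boundary hk, component_homogeneous hw, component_homogeneous hw']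
  split_ifs
  · rfl
  · rw [mulVec_zero]

theorem boundary_exact (hk : 0 < k) (p : ℕ) :
    Function.Exact (boundary K n k (p + 1)) (boundary K n k p) := by
  intro z
  constructor
  · intro hz
    rw [← LinearMap.coe_range, SetLike.mem_coe, eq_sum_homogeneous z]
    refine Submodule.sum_mem _ fun c _ => ?_
    by_cases hc : k ≤ ∑ i, c i
    · obtain ⟨w, hw, hwz⟩ := exists_mulVec_eq (K := K) hk c hc (component c z)
        (fun G hG => label_le_of_component_ne_zero hG)
        (by rw [← component_boundary hk, hz, map_zero])
      exact ⟨homogeneous c w, by rw [boundary_homogeneous hk hw, hwz]⟩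
    -- Labels of nonempty faces have degree at least k, so nothing lives in smaller multidegrees.
    · have h0 : component c z = 0 := by
        ext F
        by_contra h0
        have h1 := label_le_of_component_ne_zero h0
        exact hc ((le_sum_label hk F).trans (Finset.sum_le_sum fun i _ => h1 i))
      have : homogeneous c (component c z) = 0 := by
        rw [h0]
        ext F : 1
        simp [homogeneous]
      rw [this]
      exact Submodule.zero_mem _
  · rintro ⟨w, rfl⟩
    refine ext_component fun c => ?_
    rw [component_boundary hk, component_boundary hk, mulVec_mulVec, incMatrix_mul K hk,
      zero_mulVec, map_zero]

/-! ### The end of the resolution: vertices and the powers of the maximal ideal -/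

/-- The vertex with a given exponent vector. -/
theorem exists_vertex (hk : 0 < k) {v : Fin n →₀ ℕ} (hv : ∑ i, v i = k) :
    ∃ V : Face n k 1, label V = v := by
  have hcell : IsCell k v ∅ := Or.inl ⟨rfl, hv⟩
  let V : Face n k 1 := ofCell hk hcell rfl
  have hc : corner V = v := corner_ofCell _ _ _
  have hm : moving V = ∅ := moving_ofCell _ _ _
  refine ⟨V, ?_⟩
  ext i
  rw [label_apply hk, hc, hm]
  simp

theorem inc_empty (hk : 0 < k) (G : Face n k 0) (F : Face n k 1) : inc G F = 1 := by
  rw [inc_of_subset, incidence_empty hk]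
  rw [G.eq_emptyFace]
  exact Set.empty_subset _

theorem boundary_zero_single (hk : 0 < k) (V : Face n k 1) (f : MvPolynomial (Fin n) K) :
    boundary K n k 0 (Finsupp.single V f) =
      Finsupp.single (emptyFace n k) (f * MvPolynomial.monomial (label V) 1) := by
  classical
  ext G : 1
  rw [boundary_apply, Finset.sum_eq_single V]
  · rw [inc_empty hk, label_of_empty, G.eq_emptyFace]
    simp
  · intro F _ hF
    rw [Finsupp.single_eq_of_ne hF, zero_mul]
  · simp

theorem augmentation_single (f : MvPolynomial (Fin n) K) :
    augmentation K n k (Finsupp.single (emptyFace n k) f) = Ideal.Quotient.mk _ f := by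
  rw [augmentation, Finsupp.linearCombination_single]
  change Ideal.Quotient.mk _ (f * 1) = _
  rw [mul_one]

theorem eq_single_emptyFace (z : FreeMod K n k 0) :
    z = Finsupp.single (emptyFace n k) (z (emptyFace n k)) := by
  ext G : 1
  rw [G.eq_emptyFace, Finsupp.single_eq_same]

theorem maxIdeal_pow : maxIdeal K n ^ k = Ideal.span
    ((fun v => MvPolynomial.monomial v (1 : K)) '' {v : Fin n →₀ ℕ | ∑ i, v i = k}) := by
  have := MvPolynomial.pow_idealOfVars_eq_span (σ := Fin n) (R := K) k
  rw [MvPolynomial.idealOfVars] at this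
  rw [maxIdeal, this]
  congr 2
  ext v
  simp [Finsupp.degree_eq_sum]

theorem augmentation_exact (hk : 0 < k) :
    Function.Exact (boundary K n k 0) (augmentation K n k) := by
  intro z
  constructor
  · intro hz
    rw [eq_single_emptyFace z] at hz ⊢
    rw [augmentation_single, Ideal.Quotient.eq_zero_iff_mem, maxIdeal_pow] at hz
    have hle : Ideal.span ((fun v => MvPolynomial.monomial v (1 : K)) ''
        {v : Fin n →₀ ℕ | ∑ i, v i = k}) ≤
        (LinearMap.range (boundary K n k 0)).comap (Finsupp.lsingle (emptyFace n k)) := by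
      rw [Ideal.span, Submodule.span_le]
      rintro _ ⟨v, hv, rfl⟩
      obtain ⟨V, rfl⟩ := exists_vertex hk hv
      refine ⟨Finsupp.single V 1, ?_⟩
      rw [boundary_zero_single hk, one_mul]
      rfl
    exact hle hz
  · rintro ⟨w, rfl⟩
    have hle : LinearMap.range (boundary K n k 0) ≤ LinearMap.ker (augmentation K n k) := by
      rw [boundary, Finsupp.range_linearCombination, Submodule.span_le]
      rintro _ ⟨V, rfl⟩
      have := boundary_zero_single (K := K) hk V 1
      rw [boundary, Finsupp.linearCombination_single, one_smul] at this
      simp only [SetLike.mem_coe, LinearMap.mem_ker]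
      rw [this, augmentation_single, Ideal.Quotient.eq_zero_iff_mem, maxIdeal_pow, one_mul]
      refine Ideal.subset_span ⟨_, ?_, rfl⟩
      have := sum_label hk V
      rw [moving_vertex hk, sum_corner_vertex hk] at this
      simpa using this
    exact hle ⟨w, rfl⟩

theorem isCellularResolution (hk : 0 < k) : IsCellularResolution K n k where
  exact := boundary_exact hk
  exact_zero := augmentation_exact hk
  surjective q := by
    obtain ⟨f, rfl⟩ := Ideal.Quotient.mk_surjective q
    exact ⟨_, augmentation_single f⟩

end Resolution

end SubdividedSimplex

namespace SubdividedSimplex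
variable {n k p q : ℕ}

/-! ## Translation and multiplication by variables -/

theorem image_translate_cell (i : Fin n) (a : Fin n → ℕ) (I : Finset (Fin n)) :
    (fun y => y + Pi.single i (1 : ℝ)) '' cell k a I = cell (k + 1) (a + Pi.single i 1) I := by
  have hcast : ∀ j, ((Pi.single i 1 : Fin n → ℕ) j : ℝ) =
      (Pi.single i 1 : Fin n → ℝ) j := fun j => by
    by_cases h : j = i
    · subst h; simp
    · simp [h]
  have hmem : ∀ y : Fin n → ℝ, y ∈ cell k a I ↔
      y + Pi.single i 1 ∈ cell (k + 1) (a + Pi.single i 1) I := by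
    intro y
    simp only [cell, Set.mem_ofPred_eq, Pi.add_apply, Nat.cast_add, hcast, Finset.sum_add_distrib,
      add_right_comm _ _ (1 : ℝ), add_lt_add_iff_right, add_left_inj]
    simp
  ext z
  constructor
  · rintro ⟨y, hy, rfl⟩
    exact (hmem y).1 hy
  · intro hz
    exact ⟨z - Pi.single i 1, (hmem _).2 (by rwa [sub_add_cancel]), sub_add_cancel _ _⟩

theorem sum_add_single (a : Fin n → ℕ) (i : Fin n) :
    ∑ j, (a + Pi.single i 1 : Fin n → ℕ) j = ∑ j, a j + 1 := by
  simp [Finset.sum_add_distrib]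

theorem isCell_add_single {a : Fin n → ℕ} {I : Finset (Fin n)} (i : Fin n) :
    IsCell (k + 1) (a + Pi.single i 1) I ↔ IsCell k a I := by
  rw [IsCell, IsCell, sum_add_single]
  refine or_congr (and_congr Iff.rfl ?_) (and_congr ?_ ?_) <;> omega

/-- The translate `F + eᵢ` of a face. -/
noncomputable def translate (hk : 0 < k) (i : Fin n) (F : Face n k p) : Face n (k + 1) p :=
  ⟨(fun y => y + Pi.single i (1 : ℝ)) '' F.1, by
    obtain ⟨F, hF, hr⟩ := F
    rcases (isFace_iff hk).1 hF with rfl | ⟨a, I, h, rfl⟩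
    · rw [Set.image_empty]
      exact ⟨Or.inl rfl, hr⟩
    · have h' := (isCell_add_single i).2 h
      rw [image_translate_cell]
      refine ⟨(isFace_iff k.succ_pos).2 (Or.inr ⟨_, _, h', rfl⟩), ?_⟩
      rw [← hr, rank_cell h, rank_cell h']⟩

theorem translate_val (hk : 0 < k) (i : Fin n) (F : Face n k p) :
    (translate hk i F).1 = (fun y => y + Pi.single i (1 : ℝ)) '' F.1 := rfl

theorem translate_injective (hk : 0 < k) (i : Fin n) :
    Function.Injective (translate hk i : Face n k p → Face n (k + 1) p) := by
  intro F G h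
  exact Subtype.ext ((add_left_injective _).image_injective (congrArg Subtype.val h))

theorem translate_eq_cell (hk : 0 < k) (i : Fin n) (F : Face n k (p + 1)) :
    (translate hk i F).1 = cell (k + 1) (corner F + Pi.single i 1) (moving F) := by
  rw [translate_val, F.eq_cell hk, image_translate_cell]

theorem corner_translate (hk : 0 < k) (i : Fin n) (F : Face n k (p + 1)) :
    corner (translate hk i F) = corner F + Pi.single i 1 :=
  corner_of_eq ((isCell_add_single i).2 (F.isCell hk)) (translate_eq_cell hk i F)

theorem moving_translate (hk : 0 < k) (i : Fin n) (F : Face n k p) :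
    moving (translate hk i F) = moving F := by
  classical
  simp only [moving, translate_val, Set.exists_mem_image, Pi.add_apply, ne_eq, add_left_inj]

theorem label_translate (hk : 0 < k) (i : Fin n) (F : Face n k (p + 1)) :
    label (translate hk i F) = label F + Finsupp.single i 1 := by
  classical
  ext j
  rw [Finsupp.add_apply, label_apply hk, label_apply k.succ_pos, corner_translate,
    moving_translate, Pi.add_apply, Finsupp.single_apply, Pi.single_apply, add_right_comm]
  simp only [eq_comm]

/-- Only the inequality covers the empty face, whose label stays 1 under translation. -/
theorem label_translate_le (hk : 0 < k) (i : Fin n) (F : Face n k p) :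
    label (translate hk i F) ≤ label F + Finsupp.single i 1 := by
  rcases p with _ | p
  · rw [label_of_empty]
    exact bot_le
  · exact (label_translate hk i F).le

theorem inc_translate (hk : 0 < k) (i : Fin n) (G : Face n k p) (F : Face n k q) :
    inc (translate hk i G) (translate hk i F) = inc G F := by
  classical
  have hcl : closure (translate hk i F).1 =
      (fun y => y + Pi.single i (1 : ℝ)) '' closure F.1 :=
    ((Homeomorph.addRight (Pi.single i (1 : ℝ) : Fin n → ℝ)).image_closure F.1).symm
  have hsub : (translate hk i G).1 ⊆ closure (translate hk i F).1 ↔ G.1 ⊆ closure F.1 := by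
    rw [hcl]
    exact Set.image_subset_image_iff (add_left_injective _)
  have hinc : incidence (translate hk i G) (translate hk i F) = incidence G F := by
    simp only [incidence, moving_translate, translate_val, Set.forall_mem_image, Pi.add_apply,
      add_le_add_iff_right]
  rw [inc, inc, hinc]
  simp only [hsub]

theorem exists_translate_eq (hk : 0 < k) {i : Fin n} {G : Face n (k + 1) (p + 1)}
    (h : 0 < corner G i) : ∃ F : Face n k (p + 1), translate hk i F = G := by
  have ha : corner G - Pi.single i 1 + Pi.single i 1 = corner G := by
    ext j
    by_cases hj : j = i
    · subst hj
      simp only [Pi.add_apply, Pi.sub_apply, Pi.single_eq_same]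
      omega
    · simp [hj]
  have hcell : IsCell k (corner G - Pi.single i 1) (moving G) := by
    rw [← isCell_add_single i, ha]
    exact G.isCell k.succ_pos
  refine ⟨ofCell hk hcell (G.spec k.succ_pos).2.2, Subtype.ext ?_⟩
  rw [translate_eq_cell, corner_ofCell, moving_ofCell, ha, ← G.eq_cell k.succ_pos]

/-- Corners of faces of a cell dominate the corner of the cell, so they stay positive at i. Hence
the translates are closed under passing to facets. -/
theorem exists_translate_eq_of_subset (hk : 0 < k) {i : Fin n} {G : Face n (k + 1) p}
    {F : Face n k (p + 1)} (h : G.1 ⊆ closure (translate hk i F).1) :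
    ∃ G' : Face n k p, translate hk i G' = G := by
  rcases p with _ | p
  · refine ⟨emptyFace n k, ?_⟩
    rw [Face.eq_emptyFace (translate hk i _), ← G.eq_emptyFace]
  · refine exists_translate_eq hk ?_
    have := corner_le_of_subset k.succ_pos h i
    rw [corner_translate, Pi.add_apply, Pi.single_eq_same] at this
    omega

/-! ### Multiplication by a variable as a chain map, and finite generation -/

section Generation

variable (K : Type u) [Field K]

/-- The components of the multiplication by `xᵢ`: the generator of `F` is sent to the multiple of
the generator of `F + eᵢ` of the right multidegree. -/
noncomputable def mulVarApp (hk : 0 < k) (i : Fin n) (p : ℕ) :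
    FreeMod K n k p →ₗ[MvPolynomial (Fin n) K] FreeMod K n (k + 1) p :=
  Finsupp.linearCombination (MvPolynomial (Fin n) K) fun F : Face n k p =>
    Finsupp.single (translate hk i F)
      (MvPolynomial.monomial (label F + Finsupp.single i 1 - label (translate hk i F)) 1)

theorem mulVarApp_single (hk : 0 < k) (i : Fin n) (F : Face n k p) :
    mulVarApp K hk i p (Finsupp.single F 1) = Finsupp.single (translate hk i F)
      (MvPolynomial.monomial (label F + Finsupp.single i 1 - label (translate hk i F)) 1) := by
  rw [mulVarApp, Finsupp.linearCombination_single, one_smul]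

theorem mulVarApp_apply_translate (hk : 0 < k) (i : Fin n) (z : FreeMod K n k p)
    (G : Face n k p) : mulVarApp K hk i p z (translate hk i G) =
      z G * MvPolynomial.monomial (label G + Finsupp.single i 1 - label (translate hk i G)) 1 := by
  rw [mulVarApp, Finsupp.linearCombination_apply, Finsupp.sum_fintype _ _ (by simp),
    Finsupp.finsetSum_apply, Finset.sum_eq_single G]
  · simp
  · intro F _ hF
    rw [Finsupp.smul_apply, Finsupp.single_eq_of_ne, smul_zero]
    exact fun h => hF (translate_injective hk i h.symm)
  · simp

theorem mulVarApp_apply_of_notMem (hk : 0 < k) (i : Fin n) (z : FreeMod K n k p)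
    {G : Face n (k + 1) p} (hG : ∀ F, translate hk i F ≠ G) : mulVarApp K hk i p z G = 0 := by
  rw [mulVarApp, Finsupp.linearCombination_apply, Finsupp.sum_fintype _ _ (by simp),
    Finsupp.finsetSum_apply]
  refine Finset.sum_eq_zero fun F _ => ?_
  rw [Finsupp.smul_apply, Finsupp.single_eq_of_ne (hG F).symm, smul_zero]

theorem boundary_single_apply (F : Face n k (p + 1)) (f : MvPolynomial (Fin n) K)
    (G : Face n k p) : boundary K n k p (Finsupp.single F f) G =
      f * MvPolynomial.monomial (label F - label G) (inc G F : K) := by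
  classical
  rw [boundary_apply, Finset.sum_eq_single F]
  · rw [Finsupp.single_eq_same]
  · intro F' _ hF
    rw [Finsupp.single_eq_of_ne hF, zero_mul]
  · simp

/-- Multiplication by `xᵢ` as a chain map. -/
noncomputable def mulVar (hk : 0 < k) (i : Fin n) : ChainMap K n k (k + 1) where
  app := mulVarApp K hk i
  comm p := by
    refine Finsupp.lhom_ext' fun F => LinearMap.ext_ring ?_
    ext G : 1
    simp only [LinearMap.comp_apply, Finsupp.lsingle_apply]
    rw [mulVarApp_single, boundary_single_apply]
    by_cases hG : ∃ G', translate hk i G' = G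
    · obtain ⟨G, rfl⟩ := hG
      rw [mulVarApp_apply_translate, boundary_single_apply, inc_translate, one_mul,
        MvPolynomial.monomial_mul, MvPolynomial.monomial_mul, one_mul, mul_one]
      by_cases h0 : inc G F = 0
      · simp [h0]
      · have h1 := inc_ne_zero_iff.1 h0
        rw [← inc_translate hk i] at h0
        have h2 := label_le_of_facet k.succ_pos (inc_ne_zero_iff.1 h0)
        have h3 := label_le_of_facet hk h1
        -- Both sides are a_F + e_i - a_{G + e_i}; the four inequalities make every truncated
        -- subtraction exact.
        have key : label F + Finsupp.single i 1 - label (translate hk i F) +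
            (label (translate hk i F) - label (translate hk i G)) =
            label F - label G + (label G + Finsupp.single i 1 - label (translate hk i G)) := by
          ext j
          have e1 := h3 j
          have e2 := h2 j
          have e3 := label_translate_le hk i G j
          have e4 := label_translate_le hk i F j
          simp only [Finsupp.add_apply, Finsupp.tsub_apply] at *
          omega
        rw [key]
    · have hF : inc G (translate hk i F) = 0 := by
        by_contra h0
        exact hG (exists_translate_eq_of_subset hk (inc_ne_zero_iff.1 h0))
      rw [mulVarApp_apply_of_notMem K hk i _ fun F h => hG ⟨F, h⟩, hF]
      simp

theorem isVariableMul_mulVar (hk : 0 < k) (i : Fin n) : IsVariableMul i (mulVar K hk i) where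
  succ := rfl
  app_zero := by
    change mulVarApp K hk i 0 _ = _
    rw [mulVarApp_single, label_of_empty, label_of_empty, Face.eq_emptyFace (translate hk i _),
      zero_add, tsub_zero]
    rfl
  compatible p F := ⟨translate hk i F, rfl, _, by simp, mulVarApp_single K hk i F⟩

/-- The label of a nonempty face grows by exactly e_i, so the generator of the translate appears
with coefficient 1 and no multiple of a syzygy is lost. -/
theorem mulVar_boundary (hk : 0 < k) (i : Fin n) (F : Face n k (p + 1)) :
    (mulVar K hk i).app p (boundary K n k p (Finsupp.single F 1)) =
      boundary K n (k + 1) p (Finsupp.single (translate hk i F) 1) := by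
  have h := LinearMap.congr_fun ((mulVar K hk i).comm p) (Finsupp.single F 1)
  simp only [LinearMap.comp_apply] at h
  rw [← h]
  change boundary K n (k + 1) p (mulVarApp K hk i (p + 1) _) = _
  rw [mulVarApp_single, label_translate, tsub_self]
  rfl

/-- With corner 0 the cell would be a vertex, giving k = 0, or would satisfy k < |I| ≤ n. -/
theorem exists_corner_pos (hk : n < k) (F : Face n k (p + 1)) : ∃ i, 0 < corner F i := by
  by_contra! h
  have h0 : ∑ i, corner F i = 0 := Finset.sum_eq_zero fun i _ => Nat.le_zero.1 (h i)
  have hc : (moving F).card ≤ n := by simpa using Finset.card_le_univ (moving F)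
  rcases F.isCell (by omega) with h | h <;> omega

/-- The syzygy `∂ F` as an element of the syzygy representation. -/
noncomputable def faceSyzygy (n p : ℕ) (x : Family K n) (F : Face n x.power (p + 1)) :
    (syzygyRep K n p).obj x :=
  (boundary K n x.power p).rangeRestrict (Finsupp.single F 1)

/-- Multiplication by `xᵢ` as a morphism of the family. -/
noncomputable def mulVarHom (i : Fin n) (x : Family K n) :
    x ⟶ (⟨x.power + 1, x.power.succ_pos⟩ : Family K n) :=
  ⟨(ChainMap.id K n x.power).comp (mulVar K x.pos i),
    IsComposite.comp i (IsComposite.id _) (isVariableMul_mulVar K x.pos i)⟩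

theorem map_mulVarHom_faceSyzygy (i : Fin n) (x : Family K n) (F : Face n x.power (p + 1)) :
    ((syzygyRep K n p).map (mulVarHom K i x)).hom (faceSyzygy K n p x F) =
      faceSyzygy K n p ⟨x.power + 1, x.power.succ_pos⟩ (translate x.pos i F) :=
  Subtype.ext (mulVar_boundary K x.pos i F)

theorem faceSyzygy_mem (N : CategoryRep.Subrepresentation (syzygyRep K n p))
    (hN : ∀ (k : ℕ) (hk : 0 < k), k ≤ n + 1 → ∀ F : Face n k (p + 1),
      faceSyzygy K n p ⟨k, hk⟩ F ∈ N.obj ⟨k, hk⟩) :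
    ∀ (k : ℕ) (hk : 0 < k) (F : Face n k (p + 1)),
      faceSyzygy K n p ⟨k, hk⟩ F ∈ N.obj ⟨k, hk⟩ := by
  intro k
  induction k with
  | zero =>
    intro hk
    exact absurd hk (lt_irrefl 0)
  | succ k ih =>
    intro hk F
    by_cases hkn : k + 1 ≤ n + 1
    · exact hN _ hk hkn F
    · have hk' : 0 < k := by omega
      obtain ⟨i, hi⟩ := exists_corner_pos (by omega) F
      obtain ⟨G, rfl⟩ := exists_translate_eq hk' hi
      have := N.map_mem (mulVarHom K i ⟨k, hk'⟩) (ih hk' G)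
      rwa [map_mulVarHom_faceSyzygy] at this

theorem eq_top_of_faceSyzygy_mem (N : CategoryRep.Subrepresentation (syzygyRep K n p))
    (x : Family K n) (hN : ∀ F : Face n x.power (p + 1), faceSyzygy K n p x F ∈ N.obj x) :
    N.obj x = ⊤ := by
  rw [eq_top_iff]
  rintro ⟨_, b, rfl⟩ -
  have key : ∀ b, ((boundary K n x.power p).rangeRestrict b : (syzygyRep K n p).obj x) ∈
      N.obj x := by
    intro b
    induction b using Finsupp.induction_linear with
    | zero =>
      rw [map_zero]
      exact Submodule.zero_mem _
    | add b c hb hc =>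
      rw [map_add]
      exact Submodule.add_mem _ hb hc
    | single F f =>
      rw [← mul_one f, ← smul_eq_mul, ← Finsupp.smul_single, map_smul]
      exact Submodule.smul_mem _ f (hN F)
  exact key b

theorem syzygyRep_isFinitelyGenerated (n p : ℕ) :
    CategoryRep.IsFinitelyGenerated (syzygyRep K n p) := by
  -- The index runs over 0, …, n and is shifted by one, so the powers are 1, …, n + 1.
  refine ⟨Set.range fun e : Σ k : Fin (n + 1), Face n (k + 1) (p + 1) =>
    ⟨⟨e.1 + 1, Nat.succ_pos _⟩, faceSyzygy K n p ⟨e.1 + 1, Nat.succ_pos _⟩ e.2⟩,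
    Set.finite_range _, ?_⟩
  intro N hN x
  refine eq_top_of_faceSyzygy_mem K N x (faceSyzygy_mem K N ?_ x.power x.pos)
  rintro (_ | k) hk hkn F
  · exact absurd hk (lt_irrefl 0)
  · exact hN _ ⟨⟨⟨k, by omega⟩, F⟩, rfl⟩

end Generation

end SubdividedSimplex

theorem mainTheorem5 (K : Type*) [Field K] (n : ℕ) :
    (∀ k : ℕ, 0 < k → SubdividedSimplex.IsCellularResolution K n k) ∧
      ∀ p : ℕ, CategoryRep.IsFinitelyGenerated (SubdividedSimplex.syzygyRep K n p) :=
  ⟨fun _ hk => SubdividedSimplex.isCellularResolution hk,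
    SubdividedSimplex.syzygyRep_isFinitelyGenerated K n⟩
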